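/- Let $k$ be a field of characteristic $p>0$ and $d\ge 0$. Let $\Gamma^dP_k$ be the category whose objects are the finitely generated projective $k$-modules, with $\operatorname{Hom}(V,W)=\Gamma^d(\operatorname{Hom}_k(V,W))=\operatorname{Hom}_{S_d}(V^{\otimes d},W^{\otimes d})$, and let $\mathrm{Rep}\,\Gamma^d_k$ be the abelian category of $k$-linear functors $\Gamma^dP_k\to k\text{-Mod}$ (strict polynomial functors of degree $d$). Write $\Gamma^{d,V}=\operatorname{Hom}_{\Gamma^dP_k}(V,-)$ for the representable functors, and let $\underline{\otimes}$ be the internal tensor product (Day convolution, the $k$-linear, colimit-preserving extension of $\Gamma^{d,V}\,\underline{\otimes}\,\Gamma^{d,W}=\Gamma^{d,V\otimes W}$), with left derived functor $\overset{\mathbf L}{\underline{\otimes}}$; put $\mathrm{Sch}(X)=\operatorname{Hom}_{\mathrm{Rep}\,\Gamma^d_k}(\otimes^d,X)$, where $\otimes^d$ is the functor $V\mapsto V^{\otimes d}$. Let $X,Y$ be objects of $\mathrm{Rep}\,\Gamma^d_k$ and let $i\in\mathbb Z$, $i\neq 0$. Then $\mathrm{Sch}\bigl(H^i(X\overset{\mathbf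 L}{\underline{\otimes}}Y)\bigr)=0$. If moreover $X$ and $Y$ are finitely generated (quotients of finite direct sums of representable functors), then the highest weight of every composition factor of $H^i(X\overset{\mathbf L}{\underline{\otimes}}Y)$ is not $p$-restricted. Here the highest weight of a simple object $L$ is the greatest weight $\lambda=(\lambda_1,\dots,\lambda_d)$, for the dominance order, of the polynomial $GL_d$-representation $L(k^d)$, and $\lambda$ is $p$-restricted if $\lambda_j-\lambda_{j+1}<p$ for $1\le j\le d$, with $\lambda_{d+1}=0$. -/

import Mathlib

open CategoryTheory CategoryTheory.Limits
open scoped TensorProduct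

universe w u

noncomputable section

namespace StrictPoly

section TensorPowers

variable (k : Type u) [CommRing k] (d : ℕ)
variable (V W : Type u) [AddCommGroup V] [Module k V] [AddCommGroup W] [Module k W]

/-- The action of `σ ∈ S_d` on `V^{⊗ d}` by permuting the tensor factors. -/
def perm (σ : Equiv.Perm (Fin d)) : (⨂[k]^d V) →ₗ[k] (⨂[k]^d V) :=
  (PiTensorProduct.reindex k (fun _ : Fin d => V) σ).toLinearMap

lemma perm_tprod (σ : Equiv.Perm (Fin d)) (v : Fin d → V) :
    perm k d V σ (PiTensorProduct.tprod k v) =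
      PiTensorProduct.tprod k (fun i => v (σ.symm i)) :=
  PiTensorProduct.reindex_tprod σ v

/-- The `S_d`-equivariant maps `V^{⊗ d} → W^{⊗ d}`; this is `Γ^d (Hom (V, W))`. -/
def gammaHom : Submodule k ((⨂[k]^d V) →ₗ[k] (⨂[k]^d W)) where
  carrier := {f | ∀ σ : Equiv.Perm (Fin d), f ∘ₗ perm k d V σ = perm k d W σ ∘ₗ f}
  add_mem' := by
    intro f g hf hg σ
    rw [LinearMap.add_comp, LinearMap.comp_add, hf σ, hg σ]
  zero_mem' := by
    intro σ
    rw [LinearMap.zero_comp, LinearMap.comp_zero]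
  smul_mem' := by
    intro c f hf σ
    rw [LinearMap.smul_comp, LinearMap.comp_smul, hf σ]

/-- The map `V^{⊗ d} ⊗ W^{⊗ d} → (V ⊗ W)^{⊗ d}`,
`(v₁ ⊗ ⋯ ⊗ v_d) ⊗ (w₁ ⊗ ⋯ ⊗ w_d) ↦ (v₁ ⊗ w₁) ⊗ ⋯ ⊗ (v_d ⊗ w_d)`. -/
def shuffle : (⨂[k]^d V) ⊗[k] (⨂[k]^d W) →ₗ[k] (⨂[k]^d (V ⊗[k] W)) :=
  TensorProduct.lift (PiTensorProduct.map₂ (fun _ : Fin d => TensorProduct.mk k V W))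

lemma shuffle_tprod (v : Fin d → V) (w : Fin d → W) :
    shuffle k d V W (PiTensorProduct.tprod k v ⊗ₜ[k] PiTensorProduct.tprod k w) =
      PiTensorProduct.tprod k (fun i => v i ⊗ₜ[k] w i) := by
  rw [shuffle, TensorProduct.lift.tmul, PiTensorProduct.map₂_tprod_tprod]
  rfl

/-- The projection of the tensor algebra to its component of degree `d`. -/
def tensorAlgebraProj : TensorAlgebra k V →ₗ[k] (⨂[k]^d V) :=
  DirectSum.component k ℕ (fun n => ⨂[k]^n V) d ∘ₗ
    (TensorAlgebra.toDirectSum (R := k) (M := V)).toLinearMap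

lemma tensorAlgebraProj_tprod (v : Fin d → V) :
    tensorAlgebraProj k d V (TensorAlgebra.tprod k V d v) = PiTensorProduct.tprod k v := by
  rw [tensorAlgebraProj, LinearMap.comp_apply, AlgHom.toLinearMap_apply,
    TensorAlgebra.toDirectSum_tensorPower_tprod]
  exact DirectSum.component.lof_self k d _

/-- The inverse of `shuffle`, obtained by multiplying in `T(V) ⊗ T(W)`. -/
def unshuffle : (⨂[k]^d (V ⊗[k] W)) →ₗ[k] (⨂[k]^d V) ⊗[k] (⨂[k]^d W) :=
  TensorProduct.map (tensorAlgebraProj k d V) (tensorAlgebraProj k d W) ∘ₗ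
    PiTensorProduct.lift
      ((MultilinearMap.mkPiAlgebraFin k d (TensorAlgebra k V ⊗[k] TensorAlgebra k W)).compLinearMap
        (fun _ => TensorProduct.map (TensorAlgebra.ι k) (TensorAlgebra.ι k)))

lemma list_prod_tmul {A B : Type*} [Semiring A] [Algebra k A] [Semiring B] [Algebra k B]
    (n : ℕ) (a : Fin n → A) (b : Fin n → B) :
    (List.ofFn (fun i => a i ⊗ₜ[k] b i)).prod =
      (List.ofFn a).prod ⊗ₜ[k] (List.ofFn b).prod := by
  induction n with
  | zero => simp [Algebra.TensorProduct.one_def]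
  | succ n ih =>
    rw [List.ofFn_succ, List.ofFn_succ, List.ofFn_succ, List.prod_cons, List.prod_cons,
      List.prod_cons, ih, Algebra.TensorProduct.tmul_mul_tmul]

lemma unshuffle_tprod (v : Fin d → V) (w : Fin d → W) :
    unshuffle k d V W (PiTensorProduct.tprod k (fun i => v i ⊗ₜ[k] w i)) =
      PiTensorProduct.tprod k v ⊗ₜ[k] PiTensorProduct.tprod k w := by
  rw [unshuffle, LinearMap.comp_apply, PiTensorProduct.lift.tprod,
    MultilinearMap.compLinearMap_apply, MultilinearMap.mkPiAlgebraFin_apply]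
  simp only [TensorProduct.map_tmul]
  rw [list_prod_tmul k d (fun i => TensorAlgebra.ι k (v i)) (fun i => TensorAlgebra.ι k (w i)),
    TensorProduct.map_tmul, ← TensorAlgebra.tprod_apply, ← TensorAlgebra.tprod_apply,
    tensorAlgebraProj_tprod, tensorAlgebraProj_tprod]

lemma shuffle_unshuffle : shuffle k d V W ∘ₗ unshuffle k d V W = LinearMap.id := by
  refine PiTensorProduct.ext_of_span_eq_top
    (g := fun (_ : Fin d) (p : V × W) => p.1 ⊗ₜ[k] p.2) (fun _ => ?_) (fun j => ?_)
  · rw [← TensorProduct.span_tmul_eq_top]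
    congr 1
    ext t
    simp [Set.mem_range]
  · rw [LinearMap.comp_apply, unshuffle_tprod, shuffle_tprod, LinearMap.id_apply]

/-- Linear maps out of `V^{⊗ d} ⊗ W^{⊗ d}` are determined by their values on pure tensors. -/
lemma tensorPower_ext {N : Type*} [AddCommGroup N] [Module k N]
    {f g : (⨂[k]^d V) ⊗[k] (⨂[k]^d W) →ₗ[k] N}
    (h : ∀ (v : Fin d → V) (w : Fin d → W),
      f (PiTensorProduct.tprod k v ⊗ₜ[k] PiTensorProduct.tprod k w) =
        g (PiTensorProduct.tprod k v ⊗ₜ[k] PiTensorProduct.tprod k w)) : f = g := by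
  apply TensorProduct.ext
  apply PiTensorProduct.ext
  ext v : 1
  apply PiTensorProduct.ext
  ext w : 1
  exact h v w

lemma unshuffle_shuffle : unshuffle k d V W ∘ₗ shuffle k d V W = LinearMap.id := by
  apply tensorPower_ext
  intro v w
  rw [LinearMap.comp_apply, shuffle_tprod, unshuffle_tprod, LinearMap.id_apply]

/-- The canonical isomorphism `V^{⊗ d} ⊗ W^{⊗ d} ≃ (V ⊗ W)^{⊗ d}`. -/
def shuffleEquiv : (⨂[k]^d V) ⊗[k] (⨂[k]^d W) ≃ₗ[k] (⨂[k]^d (V ⊗[k] W)) :=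
  LinearEquiv.ofLinearMap (shuffle k d V W) (unshuffle k d V W)
    (shuffle_unshuffle k d V W) (unshuffle_shuffle k d V W)

lemma shuffle_perm (σ : Equiv.Perm (Fin d)) :
    shuffle k d V W ∘ₗ TensorProduct.map (perm k d V σ) (perm k d W σ) =
      perm k d (V ⊗[k] W) σ ∘ₗ shuffle k d V W := by
  apply tensorPower_ext
  intro v w
  rw [LinearMap.comp_apply, LinearMap.comp_apply, TensorProduct.map_tmul, perm_tprod, perm_tprod,
    shuffle_tprod, shuffle_tprod, perm_tprod]

end TensorPowers

/-- An object of the divided power category: a finitely generated projective `k`-module. -/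
structure DivPow (k : Type u) [CommRing k] (d : ℕ) : Type (u + 1) where
  carrier : Type u
  [addCommGroup : AddCommGroup carrier]
  [module : Module k carrier]
  [finite : Module.Finite k carrier]
  [projective : Module.Projective k carrier]

attribute [instance] DivPow.addCommGroup DivPow.module DivPow.finite DivPow.projective

section Category

variable (k : Type u) [CommRing k] (d : ℕ)

/-- The divided power category `Γ^d P_k`: morphisms from `V` to `W` are the `S_d`-equivariant
linear maps `V^{⊗ d} → W^{⊗ d}`, with the composition of linear maps. -/
instance : Category.{u} (DivPow k d) where
  Hom V W := gammaHom k d V.carrier W.carrier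
  id V := ⟨LinearMap.id, fun _ => rfl⟩
  comp {U V W} f g := ⟨g.1 ∘ₗ f.1, fun σ => by
    rw [LinearMap.comp_assoc, f.2 σ, ← LinearMap.comp_assoc, g.2 σ, LinearMap.comp_assoc]⟩
  id_comp _ := rfl
  comp_id _ := rfl
  assoc _ _ _ := rfl

instance : Preadditive (DivPow k d) where
  homGroup V W := inferInstanceAs (AddCommGroup (gammaHom k d V.carrier W.carrier))
  add_comp _ _ _ f f' g := Subtype.ext (LinearMap.comp_add f.1 f'.1 g.1)
  comp_add _ _ _ f g g' := Subtype.ext (LinearMap.add_comp f.1 g'.1 g.1)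

instance : Linear k (DivPow k d) where
  homModule V W := inferInstanceAs (Module k (gammaHom k d V.carrier W.carrier))
  smul_comp _ _ _ r f g := Subtype.ext (LinearMap.comp_smul g.1 r f.1)
  comp_smul _ _ _ f r g := Subtype.ext (LinearMap.smul_comp r g.1 f.1)

variable {k d}

/-- The linear map `V^{⊗ d} → W^{⊗ d}` underlying a morphism of `Γ^d P_k`. -/
def DivPow.toLin {V W : DivPow k d} (f : V ⟶ W) :
    (⨂[k]^d V.carrier) →ₗ[k] (⨂[k]^d W.carrier) := f.1

/-- The tensor product of objects of `Γ^d P_k` is the tensor product of modules. -/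
def DivPow.tensorObj (V W : DivPow k d) : DivPow k d := ⟨V.carrier ⊗[k] W.carrier⟩

/-- The tensor product of morphisms of `Γ^d P_k`: for equivariant `f : V^{⊗ d} → V'^{⊗ d}` and
`g : W^{⊗ d} → W'^{⊗ d}` it is `f ⊗ g`, with `V^{⊗ d} ⊗ W^{⊗ d}` identified with
`(V ⊗ W)^{⊗ d}` and likewise for `V'`, `W'`. -/
def DivPow.tensorHom {V V' W W' : DivPow k d} (f : V ⟶ V') (g : W ⟶ W') :
    V.tensorObj W ⟶ V'.tensorObj W' :=
  ⟨shuffle k d V'.carrier W'.carrier ∘ₗ TensorProduct.map f.1 g.1 ∘ₗ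
      unshuffle k d V.carrier W.carrier, fun σ => by
    have h : unshuffle k d V.carrier W.carrier ∘ₗ perm k d (V.carrier ⊗[k] W.carrier) σ =
        TensorProduct.map (perm k d V.carrier σ) (perm k d W.carrier σ) ∘ₗ
          unshuffle k d V.carrier W.carrier := by
      have h1 := congrArg (fun t => unshuffle k d V.carrier W.carrier ∘ₗ t ∘ₗ
        unshuffle k d V.carrier W.carrier) (shuffle_perm k d V.carrier W.carrier σ)
      simp only [← LinearMap.comp_assoc, unshuffle_shuffle, LinearMap.id_comp] at h1
      rw [LinearMap.comp_assoc _ (shuffle k d V.carrier W.carrier), shuffle_unshuffle,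
        LinearMap.comp_id] at h1
      exact h1.symm
    change (shuffle k d V'.carrier W'.carrier ∘ₗ TensorProduct.map f.1 g.1 ∘ₗ
      unshuffle k d V.carrier W.carrier) ∘ₗ perm k d (V.carrier ⊗[k] W.carrier) σ =
      perm k d (V'.carrier ⊗[k] W'.carrier) σ ∘ₗ shuffle k d V'.carrier W'.carrier ∘ₗ
        TensorProduct.map f.1 g.1 ∘ₗ unshuffle k d V.carrier W.carrier
    rw [LinearMap.comp_assoc, LinearMap.comp_assoc, h, ← LinearMap.comp_assoc _ _ (perm k d _ σ),
      ← shuffle_perm, LinearMap.comp_assoc, ← LinearMap.comp_assoc _ _ (TensorProduct.map f.1 g.1),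
      ← LinearMap.comp_assoc _ _ (TensorProduct.map (perm k d _ σ) _), ← TensorProduct.map_comp,
      ← TensorProduct.map_comp, f.2 σ, g.2 σ]⟩

end Category

section Functors

/-! The next three instances are found by search only up to a universe constraint. -/

instance (k : Type u) [CommRing k] : HasFiniteProducts (ModuleCat.{u + 1} k) :=
  Abelian.has_finite_products

instance (k : Type u) [CommRing k] : HasPullbacks (ModuleCat.{u + 1} k) :=
  Abelian.hasPullbacks

instance (k : Type u) [CommRing k] : HasPushouts (ModuleCat.{u + 1} k) :=
  Abelian.hasPushouts

variable (k : Type u) [CommRing k] (d : ℕ)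

/-- The property of being a `k`-linear functor `Γ^d P_k → k-Mod`. -/
def isLinear : ObjectProperty (DivPow k d ⥤ ModuleCat.{u + 1} k) :=
  fun X => X.Additive ∧ X.Linear k

/-- The category `Rep Γ^d_k` of strict polynomial functors of degree `d`: `k`-linear functors
`Γ^d P_k → k-Mod` and natural transformations. The objects of `Γ^d P_k` are the finitely generated
projective modules in the universe of `k` and form a class of the next universe, in which the values
of the functors are therefore taken. -/
abbrev RepGamma := (isLinear k d).FullSubcategory

variable {k d}

lemma isLinear_of_mono {X Y : DivPow k d ⥤ ModuleCat.{u + 1} k} (α : X ⟶ Y)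
    (hα : ∀ U, Mono (α.app U)) (hY : isLinear k d Y) : isLinear k d X := by
  obtain ⟨h1, h2⟩ := hY
  refine ⟨⟨fun {U V f g} => ?_⟩, ⟨fun {U V} f r => ?_⟩⟩
  · have := hα V
    rw [← cancel_mono (α.app V), Preadditive.add_comp, α.naturality, α.naturality, α.naturality,
      Functor.map_add, Preadditive.comp_add]
  · have := hα V
    rw [← cancel_mono (α.app V), Linear.smul_comp, α.naturality, α.naturality,
      Functor.map_smul, Linear.comp_smul]

lemma isLinear_of_epi {X Y : DivPow k d ⥤ ModuleCat.{u + 1} k} (α : X ⟶ Y)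
    (hα : ∀ U, Epi (α.app U)) (hX : isLinear k d X) : isLinear k d Y := by
  obtain ⟨h1, h2⟩ := hX
  refine ⟨⟨fun {U V f g} => ?_⟩, ⟨fun {U V} f r => ?_⟩⟩
  · have := hα U
    rw [← cancel_epi (α.app U), Preadditive.comp_add, ← α.naturality, ← α.naturality,
      ← α.naturality, Functor.map_add, Preadditive.add_comp]
  · have := hα U
    rw [← cancel_epi (α.app U), Linear.comp_smul, ← α.naturality, ← α.naturality,
      Functor.map_smul, Linear.smul_comp]

instance : (isLinear k d).IsClosedUnderKernels where
  kernels_le := by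
    rintro _ ⟨f, c, hc, hf⟩
    have : Mono c.ι := mono_of_isLimit_fork hc
    exact isLinear_of_mono c.ι (fun U => inferInstance) hf.1

instance : (isLinear k d).IsClosedUnderCokernels where
  cokernels_le := by
    rintro _ ⟨f, c, hc, hf⟩
    have : Epi c.π := epi_of_isColimit_cofork hc
    exact isLinear_of_epi c.π (fun U => inferInstance) hf.2

instance : (isLinear k d).IsClosedUnderFiniteProducts where
  isClosedUnderLimitsOfShape J _ := ⟨by
    rintro X ⟨⟨⟨F, π, hl⟩, hF⟩⟩
    have ext : ∀ {U : DivPow k d} {M : ModuleCat.{u + 1} k} (a b : M ⟶ X.obj U),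
        (∀ j, a ≫ (π.app j).app U = b ≫ (π.app j).app U) → a = b := fun {U M} a b h =>
      (isLimitOfPreserves ((evaluation _ _).obj U) hl).hom_ext h
    have nat : ∀ (j : Discrete J) {U V : DivPow k d} (f : U ⟶ V),
        X.map f ≫ (π.app j).app V = (π.app j).app U ≫ (F.obj j).map f :=
      fun j {U V} f => (π.app j).naturality f
    refine ⟨⟨fun {U V f g} => ext _ _ fun j => ?_⟩, ⟨fun {U V} f r => ext _ _ fun j => ?_⟩⟩
    · obtain ⟨h1, h2⟩ : isLinear k d (F.obj j) := hF j
      rw [Preadditive.add_comp, nat, nat, nat,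
        Functor.map_add, Preadditive.comp_add]
    · obtain ⟨h1, h2⟩ : isLinear k d (F.obj j) := hF j
      rw [Linear.smul_comp, nat, nat,
        Functor.map_smul, Linear.comp_smul]⟩

instance : (isLinear k d).ContainsZero where
  exists_zero := ⟨(Functor.const _).obj (ModuleCat.of k PUnit.{u + 2}),
    (Functor.isZero_iff _).2 fun _ => ModuleCat.isZero_of_subsingleton (ModuleCat.of k PUnit.{u + 2}),
    ⟨fun {_ _ _ _} => (ModuleCat.isZero_of_subsingleton (ModuleCat.of k PUnit.{u + 2})).eq_of_src _ _⟩,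
    ⟨fun {_ _} _ _ => (ModuleCat.isZero_of_subsingleton (ModuleCat.of k PUnit.{u + 2})).eq_of_src _ _⟩⟩

instance : Abelian (RepGamma k d) := inferInstance


/-- The direct sum of the representable functors `Γ^{d, V i} = Hom (V i, -)`, `i ∈ ι`. -/
def sumRepr {ι : Type (u + 1)} (V : ι → DivPow k d) : RepGamma k d where
  obj :=
    { obj U := ModuleCat.of k (Π₀ i, (V i ⟶ U))
      map f := ModuleCat.ofHom
        (DFinsupp.mapRange.linearMap fun i => Linear.rightComp k (V i) f)
      map_id U := by
        ext x
        simp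
      map_comp f g := by
        ext x
        simp }
  property := by
    refine ⟨⟨fun {U W f g} => ?_⟩, ⟨fun {U W} f r => ?_⟩⟩
    · ext x
      simp
    · ext x
      simp


lemma surjective_of_epi {X Y : RepGamma k d} (e : X ⟶ Y) [Epi e] (U : DivPow k d) :
    Function.Surjective (e.hom.app U).hom := by
  have := (isLinear k d).preservesEpimorphisms_ι_of_isNormalMonoCategory
  have h : Epi ((isLinear k d).ι.map e) := inferInstance
  have h' : Epi (e.hom.app U) := (NatTrans.epi_iff_epi_app e.hom).1 h U
  exact (ModuleCat.epi_iff_surjective _).1 h'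

/-- The element of `X (V)` to which a morphism from a direct sum of representable functors sends
the identity of `V i`. -/
def sumReprGen {ι : Type (u + 1)} (V : ι → DivPow k d) (i : ι) : (sumRepr V).obj.obj (V i) := by
  classical
  exact (DFinsupp.single i (𝟙 (V i)) : Π₀ j, (V j ⟶ V i))

lemma sumRepr_hom_ext {ι : Type (u + 1)} {V : ι → DivPow k d} {X : RepGamma k d} {α β : sumRepr V ⟶ X}
    (h : ∀ i, (α.hom.app (V i)).hom (sumReprGen V i) = (β.hom.app (V i)).hom (sumReprGen V i)) :
    α = β := by
  classical
  apply ObjectProperty.hom_ext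
  ext U : 2
  apply ModuleCat.hom_ext
  apply DFinsupp.lhom_ext'
  intro i
  ext g
  have key : ∀ γ : sumRepr V ⟶ X, (γ.hom.app U).hom (DFinsupp.single i g : Π₀ j, (V j ⟶ U)) =
      (X.obj.map g).hom ((γ.hom.app (V i)).hom (sumReprGen V i)) := by
    intro γ
    have h1 := congrArg (fun t => t.hom (sumReprGen V i)) (γ.hom.naturality g)
    refine Eq.trans ?_ h1
    change _ = (γ.hom.app U).hom (((sumRepr V).obj.map g).hom (sumReprGen V i))
    congr 1
    change _ = (DFinsupp.mapRange.linearMap fun i' => Linear.rightComp k (V i') g)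
      (DFinsupp.single i (𝟙 (V i)))
    rw [DFinsupp.mapRange.linearMap_apply, DFinsupp.mapRange_single, Linear.rightComp_apply,
      Category.id_comp]
  exact (key α).trans ((congrArg _ (h i)).trans (key β).symm)

/-- The morphism out of a direct sum of representable functors given by a family of elements
`x i ∈ X (V i)`. -/
def sumReprDesc {ι : Type (u + 1)} (V : ι → DivPow k d) (X : RepGamma k d)
    (x : ∀ i, X.obj.obj (V i)) : sumRepr V ⟶ X where
  hom :=
    { app U := by
        classical
        exact ModuleCat.ofHom (DFinsupp.lsum ℕ fun i =>
          { toFun f := (X.obj.map f).hom (x i)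
            map_add' f g := by
              have := X.property.1
              rw [Functor.map_add]; rfl
            map_smul' r f := by
              have := X.property.2
              rw [Functor.map_smul]; rfl } : (Π₀ i, (V i ⟶ U)) →ₗ[k] X.obj.obj U)
      naturality U U' f := by
        classical
        apply ModuleCat.hom_ext
        apply DFinsupp.lhom_ext'
        intro i
        ext g
        simp [sumRepr] }

lemma sumReprDesc_gen {ι : Type (u + 1)} (V : ι → DivPow k d) (X : RepGamma k d)
    (x : ∀ i, X.obj.obj (V i)) (i : ι) :
    ((sumReprDesc V X x).hom.app (V i)).hom (sumReprGen V i) = x i := by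
  classical
  refine (DFinsupp.lsum_single ..).trans ?_
  change (X.obj.map (𝟙 (V i))).hom (x i) = x i
  rw [X.obj.map_id]
  rfl

instance {ι : Type (u + 1)} (V : ι → DivPow k d) : Projective (sumRepr V) where
  factors {E X} f e _ := by
    choose y hy using fun i => surjective_of_epi e (V i) ((f.hom.app (V i)).hom (sumReprGen V i))
    refine ⟨sumReprDesc V E y, sumRepr_hom_ext fun i => ?_⟩
    rw [← hy i]
    exact congrArg _ (sumReprDesc_gen V E y i)

instance : EnoughProjectives (RepGamma k d) where
  presentation X := ⟨{
    p := sumRepr (fun x : (Σ V : DivPow k d, X.obj.obj V) => x.1)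
    f := sumReprDesc _ X (fun x => x.2)
    epi := by
      apply Functor.epi_of_epi_map (isLinear k d).ι
      apply (NatTrans.epi_iff_epi_app _).2
      intro U
      apply (ModuleCat.epi_iff_surjective _).2
      intro x
      exact ⟨_, sumReprDesc_gen (fun x : (Σ V : DivPow k d, X.obj.obj V) => x.1) X
        (fun x => x.2) ⟨U, x⟩⟩ }⟩

/-- `X` is finitely generated: a quotient of a finite direct sum of representable functors. -/
def IsFinitelyGenerated (X : RepGamma k d) : Prop :=
  ∃ (ι : Type (u + 1)) (_ : Finite ι) (V : ι → DivPow k d) (π : sumRepr V ⟶ X), Epi π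

end Functors

section InternalTensor

variable {k : Type u} [CommRing k] {d : ℕ}

/-- The data of a generator `[h, x, y]` of `(X ⊗ Y)(U)`: objects `V`, `W` of `Γ^d P_k`, an element
`h` of `Γ^{d, V ⊗ W} (U)`, and elements `x` of `X (V)` and `y` of `Y (W)`. -/
structure Gen (X Y : RepGamma k d) (U : DivPow k d) : Type (u + 1) where
  V : DivPow k d
  W : DivPow k d
  h : V.tensorObj W ⟶ U
  x : X.obj.obj V
  y : Y.obj.obj W

/-- The relations of `(X ⊗ Y)(U)`: `[h, x, y]` is `k`-linear in each of `h`, `x` and `y`, and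
`[h ∘ (f ⊗ g), x, y] = [h, X(f) x, Y(g) y]`. -/
inductive Relator (X Y : RepGamma k d) (U : DivPow k d) : (Gen X Y U →₀ k) → Prop
  | add_h (V W : DivPow k d) (h h' : V.tensorObj W ⟶ U) (x : X.obj.obj V) (y : Y.obj.obj W) :
      Relator X Y U (.single ⟨V, W, h + h', x, y⟩ 1 -
        (.single ⟨V, W, h, x, y⟩ 1 + .single ⟨V, W, h', x, y⟩ 1))
  | add_x (V W : DivPow k d) (h : V.tensorObj W ⟶ U) (x x' : X.obj.obj V) (y : Y.obj.obj W) :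
      Relator X Y U (.single ⟨V, W, h, x + x', y⟩ 1 -
        (.single ⟨V, W, h, x, y⟩ 1 + .single ⟨V, W, h, x', y⟩ 1))
  | add_y (V W : DivPow k d) (h : V.tensorObj W ⟶ U) (x : X.obj.obj V) (y y' : Y.obj.obj W) :
      Relator X Y U (.single ⟨V, W, h, x, y + y'⟩ 1 -
        (.single ⟨V, W, h, x, y⟩ 1 + .single ⟨V, W, h, x, y'⟩ 1))
  | smul_h (V W : DivPow k d) (r : k) (h : V.tensorObj W ⟶ U) (x : X.obj.obj V)
      (y : Y.obj.obj W) :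
      Relator X Y U (.single ⟨V, W, r • h, x, y⟩ 1 - .single ⟨V, W, h, x, y⟩ r)
  | smul_x (V W : DivPow k d) (r : k) (h : V.tensorObj W ⟶ U) (x : X.obj.obj V)
      (y : Y.obj.obj W) :
      Relator X Y U (.single ⟨V, W, h, r • x, y⟩ 1 - .single ⟨V, W, h, x, y⟩ r)
  | smul_y (V W : DivPow k d) (r : k) (h : V.tensorObj W ⟶ U) (x : X.obj.obj V)
      (y : Y.obj.obj W) :
      Relator X Y U (.single ⟨V, W, h, x, r • y⟩ 1 - .single ⟨V, W, h, x, y⟩ r)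
  | nat {V V' W W' : DivPow k d} (f : V ⟶ V') (g : W ⟶ W') (h : V'.tensorObj W' ⟶ U)
      (x : X.obj.obj V) (y : Y.obj.obj W) :
      Relator X Y U (.single ⟨V, W, DivPow.tensorHom f g ≫ h, x, y⟩ 1 -
        .single ⟨V', W', h, (X.obj.map f).hom x, (Y.obj.map g).hom y⟩ 1)

/-- The submodule of relations of `(X ⊗ Y)(U)`. -/
def relators (X Y : RepGamma k d) (U : DivPow k d) : Submodule k (Gen X Y U →₀ k) :=
  Submodule.span k {r | Relator X Y U r}

/-- The `k`-module `(X ⊗ Y)(U)`, the coend of `Γ^{d, V ⊗ W} (U) ⊗ X (V) ⊗ Y (W)` over `V` and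
`W`. -/
abbrev TensorVal (X Y : RepGamma k d) (U : DivPow k d) : Type (u + 1) :=
  (Gen X Y U →₀ k) ⧸ relators X Y U

/-- The class of `[h, x, y]` in `(X ⊗ Y)(U)`. -/
def tensorMk {X Y : RepGamma k d} {U : DivPow k d} (t : Gen X Y U) : TensorVal X Y U :=
  Submodule.Quotient.mk (.single t 1)

lemma tensorVal_ext {X Y : RepGamma k d} {U : DivPow k d} {N : Type*} [AddCommGroup N] [Module k N]
    {f g : TensorVal X Y U →ₗ[k] N} (h : ∀ t, f (tensorMk t) = g (tensorMk t)) : f = g := by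
  apply Submodule.linearMap_qext
  apply Finsupp.lhom_ext'
  intro t
  ext
  exact h t

/-- The map on generators induced by `Y ⟶ Y'` and `U ⟶ U'`. -/
def Gen.map {X Y Y' : RepGamma k d} {U U' : DivPow k d} (β : Y ⟶ Y') (u : U ⟶ U') (t : Gen X Y U) :
    Gen X Y' U' :=
  ⟨t.V, t.W, t.h ≫ u, t.x, (β.hom.app t.W).hom t.y⟩

lemma relators_le {X Y Y' : RepGamma k d} {U U' : DivPow k d} (β : Y ⟶ Y') (u : U ⟶ U') :
    relators X Y U ≤ (relators X Y' U').comap (Finsupp.lmapDomain k k (Gen.map β u)) := by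
  refine Submodule.span_le.2 ?_
  intro r hr
  have hs : ∀ (t : Gen X Y U) (c : k), Finsupp.lmapDomain k k (Gen.map β u) (.single t c) =
      .single (Gen.map β u t) c := fun t c => Finsupp.mapDomain_single
  refine Submodule.subset_span (?_ : Relator X Y' U' (Finsupp.lmapDomain k k (Gen.map β u) r))
  induction hr with
  | add_h V W h h' x y =>
    rw [map_sub, map_add, hs, hs, hs]
    simp only [Gen.map, Preadditive.add_comp]
    exact Relator.add_h V W (h ≫ u) (h' ≫ u) x ((β.hom.app W).hom y)
  | add_x V W h x x' y =>
    rw [map_sub, map_add, hs, hs, hs]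
    exact Relator.add_x V W (h ≫ u) x x' ((β.hom.app W).hom y)
  | add_y V W h x y y' =>
    rw [map_sub, map_add, hs, hs, hs]
    simp only [Gen.map, map_add]
    exact Relator.add_y V W (h ≫ u) x ((β.hom.app W).hom y) ((β.hom.app W).hom y')
  | smul_h V W r h x y =>
    rw [map_sub, hs, hs]
    simp only [Gen.map, Linear.smul_comp]
    exact Relator.smul_h V W r (h ≫ u) x ((β.hom.app W).hom y)
  | smul_x V W r h x y =>
    rw [map_sub, hs, hs]
    exact Relator.smul_x V W r (h ≫ u) x ((β.hom.app W).hom y)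
  | smul_y V W r h x y =>
    rw [map_sub, hs, hs]
    simp only [Gen.map, map_smul]
    exact Relator.smul_y V W r (h ≫ u) x ((β.hom.app W).hom y)
  | @nat V V' W W' f g h x y =>
    have hn : (β.hom.app W').hom ((Y.obj.map g).hom y) =
        (Y'.obj.map g).hom ((β.hom.app W).hom y) :=
      congrArg (fun t => t.hom y) (β.hom.naturality g)
    rw [map_sub, hs, hs]
    simp only [Gen.map, Category.assoc, hn]
    exact Relator.nat f g (h ≫ u) x ((β.hom.app W).hom y)

/-- The map `(X ⊗ Y)(U) → (X ⊗ Y')(U')` induced by `Y ⟶ Y'` and `U ⟶ U'`. -/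
def tensorMap {X Y Y' : RepGamma k d} {U U' : DivPow k d} (β : Y ⟶ Y') (u : U ⟶ U') :
    TensorVal X Y U →ₗ[k] TensorVal X Y' U' :=
  Submodule.mapQ _ _ (Finsupp.lmapDomain k k (Gen.map β u)) (relators_le β u)

lemma tensorMap_mk {X Y Y' : RepGamma k d} {U U' : DivPow k d} (β : Y ⟶ Y') (u : U ⟶ U')
    (t : Gen X Y U) : tensorMap β u (tensorMk t) = tensorMk (Gen.map β u t) := by
  simp [tensorMap, tensorMk]

lemma tensorMk_eq {X Y : RepGamma k d} {U : DivPow k d} {a b : Gen X Y U →₀ k}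
    (h : Relator X Y U (a - b)) :
    (Submodule.Quotient.mk a : TensorVal X Y U) = Submodule.Quotient.mk b :=
  (Submodule.Quotient.eq _).2 (Submodule.subset_span h)

/-- The internal tensor product (Day convolution) of strict polynomial functors. -/
def internalTensor (X Y : RepGamma k d) : RepGamma k d where
  obj :=
    { obj U := ModuleCat.of k (TensorVal X Y U)
      map u := ModuleCat.ofHom (tensorMap (𝟙 Y) u)
      map_id U := by
        apply ModuleCat.hom_ext
        apply tensorVal_ext
        intro t
        change tensorMap (𝟙 Y) (𝟙 U) (tensorMk t) = tensorMk t
        rw [tensorMap_mk]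
        rfl
      map_comp u v := by
        apply ModuleCat.hom_ext
        apply tensorVal_ext
        intro t
        change tensorMap (𝟙 Y) (u ≫ v) (tensorMk t) =
          tensorMap (𝟙 Y) v (tensorMap (𝟙 Y) u (tensorMk t))
        rw [tensorMap_mk, tensorMap_mk, tensorMap_mk]
        rfl }
  property := by
    refine ⟨⟨fun {U U' f g} => ?_⟩, ⟨fun {U U'} f r => ?_⟩⟩
    · apply ModuleCat.hom_ext
      apply tensorVal_ext
      intro t
      change tensorMap (𝟙 Y) (f + g) (tensorMk t) =
        tensorMap (𝟙 Y) f (tensorMk t) + tensorMap (𝟙 Y) g (tensorMk t)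
      rw [tensorMap_mk, tensorMap_mk, tensorMap_mk]
      simp only [Gen.map, Preadditive.comp_add]
      exact tensorMk_eq (Relator.add_h _ _ _ _ _ _)
    · apply ModuleCat.hom_ext
      apply tensorVal_ext
      intro t
      change tensorMap (𝟙 Y) (r • f) (tensorMk t) = r • tensorMap (𝟙 Y) f (tensorMk t)
      rw [tensorMap_mk, tensorMap_mk]
      simp only [Gen.map, Linear.comp_smul]
      refine (tensorMk_eq (Relator.smul_h _ _ _ _ _ _)).trans ?_
      rw [tensorMk, ← Submodule.Quotient.mk_smul, Finsupp.smul_single, smul_eq_mul, mul_one]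

/-- The functor `X ⊗ -` given by the internal tensor product with `X`. -/
def internalTensorLeft (X : RepGamma k d) : RepGamma k d ⥤ RepGamma k d where
  obj Y := internalTensor X Y
  map {Y Y'} β :=
    { hom :=
        { app U := ModuleCat.ofHom (tensorMap β (𝟙 U))
          naturality U U' u := by
            apply ModuleCat.hom_ext
            apply tensorVal_ext
            intro t
            change tensorMap β (𝟙 U') (tensorMap (𝟙 Y) u (tensorMk t)) =
              tensorMap (𝟙 Y') u (tensorMap β (𝟙 U) (tensorMk t))
            rw [tensorMap_mk, tensorMap_mk, tensorMap_mk, tensorMap_mk]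
            rfl } }
  map_id Y := by
    apply ObjectProperty.hom_ext
    ext U : 2
    apply ModuleCat.hom_ext
    apply tensorVal_ext
    intro t
    change tensorMap (𝟙 Y) (𝟙 U) (tensorMk t) = tensorMk t
    rw [tensorMap_mk]
    rfl
  map_comp {Y Y' Y''} β β' := by
    apply ObjectProperty.hom_ext
    ext U : 2
    apply ModuleCat.hom_ext
    apply tensorVal_ext
    intro t
    change tensorMap (β ≫ β') (𝟙 U) (tensorMk t) =
      tensorMap β' (𝟙 U) (tensorMap β (𝟙 U) (tensorMk t))
    rw [tensorMap_mk, tensorMap_mk, tensorMap_mk]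
    rfl

instance (X : RepGamma k d) : (internalTensorLeft X).Additive where
  map_add {Y Y' β β'} := by
    apply ObjectProperty.hom_ext
    ext U : 2
    apply ModuleCat.hom_ext
    apply tensorVal_ext
    intro t
    change tensorMap (β + β') (𝟙 U) (tensorMk t) =
      tensorMap β (𝟙 U) (tensorMk t) + tensorMap β' (𝟙 U) (tensorMk t)
    rw [tensorMap_mk, tensorMap_mk, tensorMap_mk]
    exact tensorMk_eq (Relator.add_y _ _ _ _ _ _)

/-- The derived internal tensor product of strict polynomial functors (in degree `0`): the left
derived functor of `X ⊗ -`, computed on a projective resolution of `Y`. -/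
def derivedInternalTensor [HasDerivedCategory (RepGamma k d)] (X Y : RepGamma k d) :
    DerivedCategory (RepGamma k d) :=
  DerivedCategory.Q.obj (((internalTensorLeft X).mapHomologicalComplex (ComplexShape.up ℤ)).obj
    (projectiveResolution Y).cochainComplex)

end InternalTensor

section Weights

variable (k : Type u) [CommRing k] (d : ℕ)

/-- The object `k^n` of `Γ^d P_k`. -/
def stdObj (n : ℕ) : DivPow k d := ⟨Fin n → k⟩

/-- The basis `e_{p 1} ⊗ ⋯ ⊗ e_{p d}` of `(k^n)^{⊗ d}`. -/
def tensorBasis (n : ℕ) : Module.Basis (Fin d → Fin n) k (⨂[k]^d (Fin n → k)) :=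
  Basis.piTensorProduct (fun _ : Fin d => Pi.basisFun k (Fin n))

lemma perm_tensorBasis (n : ℕ) (σ : Equiv.Perm (Fin d)) (q : Fin d → Fin n) :
    perm k d (Fin n → k) σ (tensorBasis k d n q) = tensorBasis k d n (q ∘ σ.symm) := by
  rw [tensorBasis, Basis.piTensorProduct_apply, Basis.piTensorProduct_apply, perm_tprod]
  rfl

variable {d}

/-- The content of `q`: the sequence whose `j`-th entry is the number of `i` with `q i = j`. This is
the weight of the basis vector `e_{q 1} ⊗ ⋯ ⊗ e_{q d}` under the diagonal torus. -/
def content {n : ℕ} (q : Fin d → Fin n) (j : Fin n) : ℕ :=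
  (Finset.univ.filter fun i => q i = j).card

lemma content_comp {n : ℕ} (q : Fin d → Fin n) (σ : Equiv.Perm (Fin d)) :
    content (q ∘ σ) = content q := by
  funext j
  refine Finset.card_bij (fun i _ => σ i) ?_ ?_ ?_
  · intro i hi
    simpa using hi
  · intro i _ i' _ h
    exact σ.injective h
  · intro i hi
    exact ⟨σ.symm i, by simpa using hi, by simp⟩

variable (d)

/-- The projection of `(k^n)^{⊗ d}` to the span of the basis vectors of weight `μ`. -/
def weightProj (n : ℕ) (μ : Fin n → ℕ) : (⨂[k]^d (Fin n → k)) →ₗ[k] (⨂[k]^d (Fin n → k)) :=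
  (tensorBasis k d n).constr k fun q => if content q = μ then tensorBasis k d n q else 0

lemma weightProj_basis (n : ℕ) (μ : Fin n → ℕ) (q : Fin d → Fin n) :
    weightProj k d n μ (tensorBasis k d n q) =
      if content q = μ then tensorBasis k d n q else 0 :=
  Module.Basis.constr_basis _ _ _ _

lemma weightProj_mem (n : ℕ) (μ : Fin n → ℕ) :
    weightProj k d n μ ∈ gammaHom k d (Fin n → k) (Fin n → k) := by
  intro σ
  apply (tensorBasis k d n).ext
  intro q
  rw [LinearMap.comp_apply, LinearMap.comp_apply, perm_tensorBasis, weightProj_basis,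
    weightProj_basis, content_comp]
  split_ifs
  · rw [perm_tensorBasis]
  · rw [map_zero]

/-- The projection of `(k^n)^{⊗ d}` to its `μ`-weight space, as an element of the Schur algebra
`S_k (n, d) = End (k^n)`. -/
def weightIdem (n : ℕ) (μ : Fin n → ℕ) : stdObj k d n ⟶ stdObj k d n :=
  ⟨weightProj k d n μ, weightProj_mem k d n μ⟩

variable {k d}

/-- The `μ`-weight space of the `S_k (n, d)`-module `X (k^n)`. -/
def weightSpace (X : RepGamma k d) (n : ℕ) (μ : Fin n → ℕ) : Submodule k (X.obj.obj (stdObj k d n)) :=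
  LinearMap.range (X.obj.map (weightIdem k d n μ)).hom

/-- `lam = (lam_1, …, lam_d)` is the highest weight of `L`: it is a weight of `L (k^d)`, and it is
the greatest one in the dominance order. -/
def IsHighestWeight (L : RepGamma k d) (lam : Fin d → ℕ) : Prop :=
  weightSpace L d lam ≠ ⊥ ∧
    ∀ μ : Fin d → ℕ, weightSpace L d μ ≠ ⊥ →
      ∀ m : ℕ, ∑ j with j.val < m, μ j ≤ ∑ j with j.val < m, lam j

/-- `lam` is `p`-restricted: `lam_j - lam_{j+1} < p` for all `j`, where `lam_j = 0` for `j > d`. -/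
def IsRestricted (p : ℕ) {d : ℕ} (lam : Fin d → ℕ) : Prop :=
  ∀ j : Fin d, lam j < (if h : j.val + 1 < d then lam ⟨j.val + 1, h⟩ else 0) + p

variable (k d)

/-- The strict polynomial functor `⊗^d : V ↦ V^{⊗ d}`. -/
def tensorPowerFunctor : RepGamma k d where
  obj :=
    { obj U := ModuleCat.of k (ULift.{u + 1} (⨂[k]^d U.carrier))
      map f := ModuleCat.ofHom
        (ULift.moduleEquiv.symm.toLinearMap ∘ₗ DivPow.toLin f ∘ₗ ULift.moduleEquiv.toLinearMap)
      map_id _ := rfl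
      map_comp _ _ := rfl }
  property := ⟨⟨rfl⟩, ⟨fun _ _ => rfl⟩⟩

variable {k d}

/-- The Schur functor `Sch (X) = Hom (⊗^d, X)`, as an abelian group (the action of `S_d`, by
precomposition, plays no role in its vanishing). -/
abbrev Sch (X : RepGamma k d) : Type (u + 1) := tensorPowerFunctor k d ⟶ X

/-- `L` is a composition factor of `H`: a simple subquotient of `H`. -/
def IsCompositionFactor (L H : RepGamma k d) : Prop :=
  Simple L ∧ ∃ (B : RepGamma k d) (ι : B ⟶ H) (π : B ⟶ L), Mono ι ∧ Epi π

end Weights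

end StrictPoly

end

open StrictPoly

noncomputable section

namespace StrictPoly

/-! ### Traces over the symmetric group and the weight (1, …, 1) -/

section Trace

variable {k : Type u} [CommRing k] {d : ℕ}

/-! Everything is read off from the weight space of weight (1, …, 1) in `X (k^d)`. The idempotent of
this weight is the trace `∑ σ φ σ⁻¹` over `S_d` of a map of rank one, and every trace of a map of
rank one factors through it (`rankOne_eq_comp`). So if this weight space is zero, then `Sch X = 0`,
because `e_1 ⊗ ⋯ ⊗ e_d` can be moved to any vector of `U^{⊗ d}` by such a trace; and over a field
all traces act on `X` by zero (`act_trace_of_weightSpace`).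

Homology in nonzero degree. A morphism `V ⊗ W ⟶ k^d` followed by the idempotent is given by a
functional on `(V ⊗ W)^{⊗ d} ≃ V^{⊗ d} ⊗ W^{⊗ d}`, hence over a field by a tensor of functionals,
which can be moved onto `x` and `y` separately. So the idempotent on `(X ⊗ Y)(k^d)` factors,
naturally in `Y`, through `X (k^d) ⊗ Y (k^d)` (`tensorIncl_tensorProj`). The latter is exact in `Y`,
so where a resolution of `Y` is exact, the homology after applying `X ⊗ -` has no weight (1, …, 1).

Composition factors. Absence of a weight passes to subquotients, so it suffices that a functor with
`p`-restricted highest weight `λ` has the weight (1, …, 1)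
(`weightSpace_one_ne_bot_of_isRestricted`). Suppose not. Let `v` have weight `λ`, let `x` be its
image under the first inclusion into `X (k^d ⊕ k^d)`, and let `M` be the span of `x` under products
of elements of the Lie algebra `𝔤𝔩`.

The second projection kills `M`: a product of Lie algebra elements between the first inclusion and
the second projection is a sum over the ways of distributing the factors among the `d` slots. A way
that leaves a slot empty contributes zero, and `S_d` permutes the others freely, so the sum is a
trace.

On the other hand, `M` is stable under enough unipotent matrices. For `E` a simple lowering
operator, or a matrix unit from `e_d` to the second summand, the divided powers of exponent at least
`p` kill `x` by restrictedness, and those of smaller exponent are `E^m / m!`. Commutators then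
provide all matrix units from the first summand to the second, and with them a matrix stabilizing
`M` that sends `x` to a vector with second projection `v`. Hence `v = 0`. -/

lemma perm_one (V : Type u) [AddCommGroup V] [Module k V] :
    perm k d V 1 = LinearMap.id := by
  apply PiTensorProduct.ext
  ext v
  exact perm_tprod k d V 1 v

lemma perm_mul (V : Type u) [AddCommGroup V] [Module k V] (σ τ : Equiv.Perm (Fin d)) :
    perm k d V (σ * τ) = perm k d V σ ∘ₗ perm k d V τ := by
  apply PiTensorProduct.ext
  ext v
  simp [perm_tprod, Equiv.Perm.mul_def]

lemma perm_perm (V : Type u) [AddCommGroup V] [Module k V] (σ τ : Equiv.Perm (Fin d))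
    (x : ⨂[k]^d V) : perm k d V σ (perm k d V τ x) = perm k d V (σ * τ) x := by
  rw [perm_mul, LinearMap.comp_apply]

/-- The trace `∑ σ φ σ⁻¹` of a linear map `V^{⊗ d} → W^{⊗ d}`. -/
def trace (V W : DivPow k d) :
    ((⨂[k]^d V.carrier) →ₗ[k] (⨂[k]^d W.carrier)) →ₗ[k] (V ⟶ W) :=
  LinearMap.codRestrict (gammaHom k d V.carrier W.carrier)
    (∑ σ : Equiv.Perm (Fin d), LinearMap.lcomp k _ (perm k d V.carrier σ⁻¹) ∘ₗ
      LinearMap.llcomp k _ _ _ (perm k d W.carrier σ)) (by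
    intro φ τ
    refine LinearMap.ext fun x => ?_
    simp only [LinearMap.sum_apply, LinearMap.comp_apply, LinearMap.lcomp_apply,
      LinearMap.llcomp_apply, map_sum, perm_perm]
    refine Fintype.sum_equiv (Equiv.mulLeft τ⁻¹) _ _ fun σ => ?_
    simp)

lemma trace_apply {V W : DivPow k d} (φ : (⨂[k]^d V.carrier) →ₗ[k] (⨂[k]^d W.carrier))
    (x : ⨂[k]^d V.carrier) :
    (trace V W φ).1 x =
      ∑ σ : Equiv.Perm (Fin d), perm k d W.carrier σ (φ (perm k d V.carrier σ⁻¹ x)) := by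
  change (∑ σ : Equiv.Perm (Fin d), LinearMap.lcomp k _ (perm k d V.carrier σ⁻¹) ∘ₗ
      LinearMap.llcomp k _ _ _ (perm k d W.carrier σ)) φ x = _
  simp only [LinearMap.sum_apply, LinearMap.comp_apply, LinearMap.lcomp_apply,
    LinearMap.llcomp_apply]

lemma comp_trace {U V W : DivPow k d} (f : U ⟶ V)
    (φ : (⨂[k]^d V.carrier) →ₗ[k] (⨂[k]^d W.carrier)) :
    f ≫ trace V W φ = trace U W (φ ∘ₗ f.1) := by
  apply Subtype.ext
  refine LinearMap.ext fun x => ?_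
  change (trace V W φ).1 (f.1 x) = _
  simp only [trace_apply, LinearMap.comp_apply]
  refine Finset.sum_congr rfl fun σ _ => ?_
  rw [← LinearMap.comp_apply (perm k d V.carrier σ⁻¹), ← f.2 σ⁻¹, LinearMap.comp_apply]

lemma trace_comp {V W U : DivPow k d} (φ : (⨂[k]^d V.carrier) →ₗ[k] (⨂[k]^d W.carrier))
    (g : W ⟶ U) : trace V W φ ≫ g = trace V U (g.1 ∘ₗ φ) := by
  apply Subtype.ext
  refine LinearMap.ext fun x => ?_
  change g.1 ((trace V W φ).1 x) = _
  simp only [trace_apply, LinearMap.comp_apply, map_sum]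
  refine Finset.sum_congr rfl fun σ _ => ?_
  rw [← LinearMap.comp_apply g.1, g.2 σ, LinearMap.comp_apply]

/-- The trace of the map `x ↦ ξ x • u` of rank one. -/
def rankOne (V W : DivPow k d) (ξ : Module.Dual k (⨂[k]^d V.carrier)) (u : ⨂[k]^d W.carrier) :
    V ⟶ W :=
  trace V W (ξ.smulRight u)

lemma comp_rankOne {U V W : DivPow k d} (f : U ⟶ V) (ξ : Module.Dual k (⨂[k]^d V.carrier))
    (u : ⨂[k]^d W.carrier) : f ≫ rankOne V W ξ u = rankOne U W (ξ ∘ₗ f.1) u :=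
  comp_trace f _

lemma rankOne_comp {V W U : DivPow k d} (ξ : Module.Dual k (⨂[k]^d V.carrier))
    (u : ⨂[k]^d W.carrier) (g : W ⟶ U) : rankOne V W ξ u ≫ g = rankOne V U ξ (g.1 u) := by
  rw [rankOne, trace_comp, rankOne]
  congr 1
  refine LinearMap.ext fun x => ?_
  simp

variable (k d)

/-- `tensorBasis k d n` as a basis of the tensor power of the object `k^n` of `Γ^d P_k`. -/
def stdBasis (n : ℕ) : Module.Basis (Fin d → Fin n) k (⨂[k]^d (stdObj k d n).carrier) :=
  tensorBasis k d n

/-- The vector `e_1 ⊗ ⋯ ⊗ e_d` of `(k^d)^{⊗ d}`. -/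
def multVec : ⨂[k]^d (stdObj k d d).carrier := stdBasis k d d id

/-- The coordinate of `e_1 ⊗ ⋯ ⊗ e_d` on `(k^d)^{⊗ d}`. -/
def multCoord : Module.Dual k (⨂[k]^d (stdObj k d d).carrier) := (stdBasis k d d).coord id

variable {k d}

lemma perm_stdBasis {n : ℕ} (σ : Equiv.Perm (Fin d)) (q : Fin d → Fin n) :
    perm k d (stdObj k d n).carrier σ (stdBasis k d n q) = stdBasis k d n (q ∘ σ.symm) :=
  perm_tensorBasis k d n σ q

lemma weightIdem_stdBasis {n : ℕ} (μ : Fin n → ℕ) (q : Fin d → Fin n) :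
    (weightIdem k d n μ).1 (stdBasis k d n q) = if content q = μ then stdBasis k d n q else 0 :=
  weightProj_basis k d n μ q

lemma multCoord_basis (q : Fin d → Fin d) :
    multCoord k d (stdBasis k d d q) = if q = id then 1 else 0 := by
  classical
  rw [multCoord, Module.Basis.coord_apply, Module.Basis.repr_self, Finsupp.single_apply]

/-- The vector `e_1 ⊗ ⋯ ⊗ e_d` has trivial stabilizer in `S_d`, so its coordinate picks out one
summand of a trace. -/
lemma multCoord_perm_multVec (σ : Equiv.Perm (Fin d)) :
    multCoord k d (perm k d _ σ (multVec k d)) = if σ = 1 then 1 else 0 := by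
  rw [multVec, perm_stdBasis, multCoord_basis]
  congr 1
  rw [eq_iff_iff, Function.id_comp]
  constructor
  · intro h
    rw [← inv_eq_one]
    exact Equiv.ext (congrFun h)
  · rintro rfl
    rfl

lemma multCoord_rankOne_apply {V : DivPow k d} (ξ : Module.Dual k (⨂[k]^d V.carrier))
    (x : ⨂[k]^d V.carrier) :
    multCoord k d ((rankOne V (stdObj k d d) ξ (multVec k d)).1 x) = ξ x := by
  rw [rankOne, trace_apply, map_sum, Finset.sum_eq_single 1]
  · rw [LinearMap.smulRight_apply, map_smul, map_smul, multCoord_perm_multVec]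
    simp [perm_one]
  · intro σ _ hσ
    rw [LinearMap.smulRight_apply, map_smul, map_smul, multCoord_perm_multVec, if_neg hσ, smul_zero]
  · simp

/-- Together with `comp_weightIdem_one`, this identifies the morphisms from `V` into the summand of
`k^d` cut out by the idempotent with the dual of `V^{⊗ d}`. -/
lemma multCoord_rankOne {V : DivPow k d} (ξ : Module.Dual k (⨂[k]^d V.carrier)) :
    multCoord k d ∘ₗ (rankOne V (stdObj k d d) ξ (multVec k d)).1 = ξ :=
  LinearMap.ext (multCoord_rankOne_apply ξ)

lemma rankOne_multVec {W : DivPow k d} (u : ⨂[k]^d W.carrier) :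
    (rankOne (stdObj k d d) W (multCoord k d) u).1 (multVec k d) = u := by
  rw [rankOne, trace_apply, Finset.sum_eq_single 1]
  · rw [LinearMap.smulRight_apply, multCoord_perm_multVec]
    simp [perm_one]
  · intro σ _ hσ
    rw [LinearMap.smulRight_apply, multCoord_perm_multVec, if_neg (by simpa using hσ), zero_smul,
      map_zero]
  · simp

lemma content_eq_one_iff (q : Fin d → Fin d) :
    content q = (fun _ => 1) ↔ Function.Bijective q := by
  rw [Function.bijective_iff_existsUnique, funext_iff]
  refine forall_congr' fun j => ?_
  rw [content, Finset.card_eq_one, Finset.singleton_iff_unique_mem]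
  simp

variable (k d) in
-- The basis vectors of weight (1, …, 1) form a single free `S_d`-orbit, and the projection to the
-- span of a free orbit is the trace of the projection to one of its members.
lemma weightIdem_one :
    weightIdem k d d (fun _ => 1) =
      rankOne (stdObj k d d) (stdObj k d d) (multCoord k d) (multVec k d) := by
  apply Subtype.ext
  apply (stdBasis k d d).ext
  intro q
  rw [weightIdem_stdBasis, rankOne, trace_apply]
  have hq : ∀ σ : Equiv.Perm (Fin d),
      perm k d (stdObj k d d).carrier σ⁻¹ (stdBasis k d d q) = stdBasis k d d (q ∘ σ) :=
    fun σ => perm_stdBasis σ⁻¹ q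
  simp only [hq, LinearMap.smulRight_apply, multVec, multCoord_basis, ite_smul, one_smul, zero_smul,
    content_eq_one_iff]
  split_ifs with h
  -- For bijective `q`, only `σ = q⁻¹` carries the basis vector indexed by `q` to `e_1 ⊗ ⋯ ⊗ e_d`.
  · rw [Finset.sum_eq_single (Equiv.ofBijective q h).symm]
    · rw [if_pos]
      · rw [perm_stdBasis]
        exact congrArg _ (funext fun i => rfl)
      · exact funext fun i => Equiv.apply_symm_apply (Equiv.ofBijective q h) i
    · intro σ _ hσ
      rw [if_neg, map_zero]
      intro hh
      apply hσ
      ext i : 1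
      rw [Equiv.eq_symm_apply]
      exact congrFun hh i
    · simp
  · symm
    apply Finset.sum_eq_zero
    intro σ _
    rw [if_neg, map_zero]
    intro hh
    apply h
    have : q = σ.symm := by
      funext i
      have := congrFun hh (σ.symm i)
      simpa using this
    rw [this]
    exact σ.symm.bijective

lemma comp_weightIdem_one {V : DivPow k d} (h : V ⟶ stdObj k d d) :
    h ≫ weightIdem k d d (fun _ => 1) =
      rankOne V (stdObj k d d) (multCoord k d ∘ₗ h.1) (multVec k d) := by
  rw [weightIdem_one, comp_rankOne]

lemma rankOne_eq_comp {V W : DivPow k d} (ξ : Module.Dual k (⨂[k]^d V.carrier))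
    (u : ⨂[k]^d W.carrier) :
    rankOne V W ξ u = rankOne V (stdObj k d d) ξ (multVec k d) ≫
      weightIdem k d d (fun _ => 1) ≫ rankOne (stdObj k d d) W (multCoord k d) u := by
  rw [weightIdem_one, comp_rankOne, multCoord_rankOne, rankOne_comp,
    rankOne_multVec]

end Trace

/-! ### Action of morphisms on functors, and vanishing of the weight (1, …, 1) -/

section Action

variable {k : Type u} [CommRing k] {d : ℕ} (X : RepGamma k d)

/-- The linear map by which a morphism of `Γ^d P_k` acts on a strict polynomial functor. -/
def act {V W : DivPow k d} (f : V ⟶ W) : X.obj.obj V →ₗ[k] X.obj.obj W := (X.obj.map f).hom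

lemma act_id {V : DivPow k d} (x : X.obj.obj V) : act X (𝟙 V) x = x := by
  simp [act]

lemma act_comp {U V W : DivPow k d} (f : U ⟶ V) (g : V ⟶ W) (x : X.obj.obj U) :
    act X (f ≫ g) x = act X g (act X f x) := by
  simp [act]

/-- The action of the morphisms of `Γ^d P_k` is linear. -/
def actHom (V W : DivPow k d) : (V ⟶ W) →ₗ[k] X.obj.obj V →ₗ[k] X.obj.obj W where
  toFun f := act X f
  map_add' f g := by
    have := X.property.1
    rw [act, Functor.map_add]; rfl
  map_smul' r f := by
    have := X.property.2
    rw [act, Functor.map_smul]; rfl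

lemma act_zero {V W : DivPow k d} (x : X.obj.obj V) : act X (0 : V ⟶ W) x = 0 :=
  congrArg (fun f : X.obj.obj V →ₗ[k] X.obj.obj W => f x) (map_zero (actHom X V W))

lemma act_smul {V W : DivPow k d} (r : k) (f : V ⟶ W) (x : X.obj.obj V) :
    act X (r • f) x = r • act X f x :=
  congrArg (fun f : X.obj.obj V →ₗ[k] X.obj.obj W => f x) (map_smul (actHom X V W) r f)

lemma act_sum {ι : Type*} (s : Finset ι) {V W : DivPow k d} (f : ι → (V ⟶ W))
    (x : X.obj.obj V) : act X (∑ i ∈ s, f i) x = ∑ i ∈ s, act X (f i) x := by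
  refine (congrArg (fun f : X.obj.obj V →ₗ[k] X.obj.obj W => f x)
    (map_sum (actHom X V W) f s)).trans ?_
  rw [LinearMap.sum_apply]
  rfl

variable {X}

lemma weightSpace_eq_bot_iff {n : ℕ} {μ : Fin n → ℕ} :
    weightSpace X n μ = ⊥ ↔ act X (weightIdem k d n μ) = 0 :=
  LinearMap.range_eq_bot

lemma hom_act {Z : RepGamma k d} (α : X ⟶ Z) {V W : DivPow k d} (f : V ⟶ W)
    (x : X.obj.obj V) :
    (α.hom.app W).hom (act X f x) = act Z f ((α.hom.app V).hom x) :=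
  congrArg (fun t => t.hom x) (α.hom.naturality f)

lemma act_rankOne_of_weightSpace (h : weightSpace X d (fun _ => 1) = ⊥) {V W : DivPow k d}
    (ξ : Module.Dual k (⨂[k]^d V.carrier)) (u : ⨂[k]^d W.carrier) :
    act X (rankOne V W ξ u) = 0 := by
  refine LinearMap.ext fun x => ?_
  rw [rankOne_eq_comp, act_comp, act_comp, weightSpace_eq_bot_iff.1 h]
  simp

/-- Any `u` in `U^{⊗ d}` is the image of `e_1 ⊗ ⋯ ⊗ e_d` under a trace of rank one, and such a trace
acts on `X` by zero; naturality then kills the value at `u`. -/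
lemma subsingleton_sch_of_weightSpace (h : weightSpace X d (fun _ => 1) = ⊥) :
    Subsingleton (Sch X) := by
  have key : ∀ f : Sch X, f = 0 := by
    intro f
    apply ObjectProperty.hom_ext
    ext U : 2
    apply ModuleCat.hom_ext
    ext1 y
    obtain ⟨u⟩ := y
    have h1 := hom_act f (rankOne (stdObj k d d) U (multCoord k d) u) ⟨multVec k d⟩
    rw [act_rankOne_of_weightSpace h, LinearMap.zero_apply] at h1
    refine Eq.trans ?_ h1
    congr 1
    exact congrArg ULift.up (rankOne_multVec u).symm
  exact ⟨fun f g => (key f).trans (key g).symm⟩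

lemma injective_of_mono {X Y : RepGamma k d} (e : X ⟶ Y) [Mono e] (U : DivPow k d) :
    Function.Injective (e.hom.app U).hom := by
  have := (isLinear k d).preservesMonomorphisms_ι_of_isNormalEpiCategory
  have h : Mono ((isLinear k d).ι.map e) := inferInstance
  have h' : Mono (e.hom.app U) := (NatTrans.mono_iff_mono_app e.hom).1 h U
  exact (ModuleCat.mono_iff_injective _).1 h'

lemma weightSpace_eq_bot_of_mono {X Y : RepGamma k d} (e : X ⟶ Y) [Mono e] {n : ℕ} {μ : Fin n → ℕ}
    (h : weightSpace Y n μ = ⊥) : weightSpace X n μ = ⊥ := by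
  rw [weightSpace_eq_bot_iff] at h ⊢
  refine LinearMap.ext fun x => ?_
  apply injective_of_mono e
  rw [hom_act, h]
  simp

lemma weightSpace_eq_bot_of_epi {X Y : RepGamma k d} (e : X ⟶ Y) [Epi e] {n : ℕ} {μ : Fin n → ℕ}
    (h : weightSpace X n μ = ⊥) : weightSpace Y n μ = ⊥ := by
  rw [weightSpace_eq_bot_iff] at h ⊢
  ext1 y
  obtain ⟨x, rfl⟩ := surjective_of_epi e _ y
  rw [← hom_act, h]
  simp

end Action

end StrictPoly

namespace StrictPoly

/-! ### Divided powers and the Lie algebra inside the Schur algebra -/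

section Powers

variable {k : Type u} [CommRing k] {d : ℕ}

lemma sum_comp_linearMap {ι A B C : Type*} [AddCommMonoid A] [AddCommMonoid B] [AddCommMonoid C]
    [Module k A] [Module k B] [Module k C] (s : Finset ι) (f : ι → B →ₗ[k] C) (g : A →ₗ[k] B) :
    (∑ i ∈ s, f i) ∘ₗ g = ∑ i ∈ s, f i ∘ₗ g := by
  ext x
  simp

lemma comp_sum_linearMap {ι A B C : Type*} [AddCommMonoid A] [AddCommMonoid B] [AddCommMonoid C]
    [Module k A] [Module k B] [Module k C] (s : Finset ι) (f : B →ₗ[k] C) (g : ι → A →ₗ[k] B) :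
    f ∘ₗ (∑ i ∈ s, g i) = ∑ i ∈ s, f ∘ₗ g i := by
  ext x
  simp

lemma coe_comp {U V W : DivPow k d} (f : U ⟶ V) (g : V ⟶ W) : (f ≫ g).1 = g.1 ∘ₗ f.1 := rfl

lemma perm_comp_map {V W : Type u} [AddCommGroup V] [Module k V] [AddCommGroup W] [Module k W]
    (σ : Equiv.Perm (Fin d)) (f : Fin d → V →ₗ[k] W) :
    perm k d W σ ∘ₗ PiTensorProduct.map f =
      PiTensorProduct.map (fun s => f (σ.symm s)) ∘ₗ perm k d V σ := by
  apply PiTensorProduct.ext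
  ext v
  simp [perm_tprod]

lemma map_eq_zero_of_eq_zero {V W : Type u} [AddCommGroup V] [Module k V] [AddCommGroup W]
    [Module k W] (f : Fin d → V →ₗ[k] W) (s : Fin d) (h : f s = 0) :
    PiTensorProduct.map f = 0 :=
  (PiTensorProduct.mapMultilinear k (fun _ : Fin d => V) (fun _ : Fin d => W)).map_coord_zero s h

lemma map_add_smul_eq_sum {V W : Type u} [AddCommGroup V] [Module k V] [AddCommGroup W]
    [Module k W] (g h : V →ₗ[k] W) (c : k) :
    PiTensorProduct.map (fun _ : Fin d => g + c • h) =
      ∑ m ∈ Finset.range (d + 1), ∑ S ∈ Finset.powersetCard m (Finset.univ : Finset (Fin d)),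
        c ^ m • PiTensorProduct.map (S.piecewise (fun _ => h) fun _ => g) := by
  have h0 : (fun _ : Fin d => g + c • h) = (fun _ => c • h) + fun _ => g :=
    funext fun _ => add_comm _ _
  rw [h0]
  refine ((PiTensorProduct.mapMultilinear k (fun _ : Fin d => V)
    (fun _ : Fin d => W)).map_add_univ _ _).trans ?_
  rw [← Finset.powerset_univ, Finset.sum_powerset]
  simp only [Finset.card_univ, Fintype.card_fin]
  refine Finset.sum_congr rfl fun m _ => Finset.sum_congr rfl fun S hS => ?_
  have h2 := (PiTensorProduct.mapMultilinear k (fun _ : Fin d => V)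
    (fun _ : Fin d => W)).map_piecewise_smul (fun _ => c) (S.piecewise (fun _ => h) fun _ => g) S
  rw [Finset.prod_const, (Finset.mem_powersetCard.1 hS).2] at h2
  rw [← PiTensorProduct.mapMultilinear_apply, ← h2]
  congr 1
  funext s
  by_cases hs : s ∈ S <;> simp [hs]

/-- The morphism `g^{⊗ d}` of `Γ^d P_k` given by a linear map `g`. -/
def powHom {V W : DivPow k d} (g : V.carrier →ₗ[k] W.carrier) : V ⟶ W :=
  ⟨PiTensorProduct.map fun _ => g, fun σ => (perm_comp_map σ fun _ => g).symm⟩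

lemma coe_powHom {V W : DivPow k d} (g : V.carrier →ₗ[k] W.carrier) :
    (powHom g : V ⟶ W).1 = PiTensorProduct.map fun _ => g := rfl

lemma powHom_id (V : DivPow k d) : powHom (LinearMap.id : V.carrier →ₗ[k] V.carrier) = 𝟙 V :=
  Subtype.ext PiTensorProduct.map_id

lemma powHom_comp {U V W : DivPow k d} (f : U.carrier →ₗ[k] V.carrier)
    (g : V.carrier →ₗ[k] W.carrier) : powHom f ≫ powHom g = powHom (g ∘ₗ f) :=
  Subtype.ext (PiTensorProduct.map_comp (fun _ => g) (fun _ => f)).symm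

/-- The coefficient of `t^m` in `(g + t h)^{⊗ d}`. -/
def powCoeff {V W : DivPow k d} (m : ℕ) (g h : V.carrier →ₗ[k] W.carrier) : V ⟶ W :=
  ⟨∑ S ∈ Finset.powersetCard m (Finset.univ : Finset (Fin d)),
      PiTensorProduct.map (S.piecewise (fun _ => h) fun _ => g), fun σ => by
    rw [sum_comp_linearMap, comp_sum_linearMap]
    simp only [perm_comp_map]
    refine Finset.sum_bij' (fun S _ => S.map σ.symm.toEmbedding) (fun S _ => S.map σ.toEmbedding)
      ?_ ?_ ?_ ?_ ?_
    · intro S hS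
      simpa [Finset.mem_powersetCard] using hS
    · intro S hS
      simpa [Finset.mem_powersetCard] using hS
    · intro S _
      ext i
      simp
    · intro S _
      ext i
      simp
    · intro S _
      congr 2
      funext s
      simp [Finset.piecewise]⟩

lemma coe_powCoeff {V W : DivPow k d} (m : ℕ) (g h : V.carrier →ₗ[k] W.carrier) :
    (powCoeff m g h : V ⟶ W).1 = ∑ S ∈ Finset.powersetCard m (Finset.univ : Finset (Fin d)),
      PiTensorProduct.map (S.piecewise (fun _ => h) fun _ => g) := rfl

lemma powHom_add_smul {V W : DivPow k d} (g h : V.carrier →ₗ[k] W.carrier) (c : k) :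
    powHom (V := V) (W := W) (g + c • h) =
      ∑ m ∈ Finset.range (d + 1), c ^ m • powCoeff (V := V) (W := W) m g h := by
  apply Subtype.ext
  have h1 : (∑ m ∈ Finset.range (d + 1), c ^ m • powCoeff (V := V) (W := W) m g h).1 =
      ∑ m ∈ Finset.range (d + 1), c ^ m • (powCoeff (V := V) (W := W) m g h).1 :=
    map_sum (gammaHom k d V.carrier W.carrier).subtype _ _
  rw [h1, coe_powHom]
  refine (map_add_smul_eq_sum g h c).trans (Finset.sum_congr rfl fun m _ => ?_)
  rw [coe_powCoeff, Finset.smul_sum]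

/-- The endomorphism `∑ 1 ⊗ ⋯ ⊗ F ⊗ ⋯ ⊗ 1` of `V` by which the Lie algebra `𝔤𝔩 (V)` acts. -/
def derivHom {V : DivPow k d} (F : V.carrier →ₗ[k] V.carrier) : V ⟶ V :=
  ⟨∑ s : Fin d, PiTensorProduct.map (Function.update (fun _ => LinearMap.id) s F), fun σ => by
    rw [sum_comp_linearMap, comp_sum_linearMap]
    simp only [perm_comp_map]
    refine Fintype.sum_equiv σ.symm _ _ fun s => ?_
    congr 2
    funext t
    simp [Function.update_apply]⟩

lemma coe_derivHom {V : DivPow k d} (F : V.carrier →ₗ[k] V.carrier) :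
    (derivHom F : V ⟶ V).1 =
      ∑ s : Fin d, PiTensorProduct.map (Function.update (fun _ => LinearMap.id) s F) := rfl

/-- For invertible `g` this says that conjugation by `g` preserves the Lie algebra. -/
lemma derivHom_comp_powHom {V : DivPow k d} (F F' g : V.carrier →ₗ[k] V.carrier)
    (h : g ∘ₗ F = F' ∘ₗ g) :
    derivHom (V := V) F ≫ powHom (W := V) g = powHom (V := V) g ≫ derivHom (V := V) F' := by
  apply Subtype.ext
  rw [coe_comp, coe_comp, coe_derivHom, coe_derivHom, coe_powHom,
    sum_comp_linearMap, comp_sum_linearMap]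
  refine Finset.sum_congr rfl fun s _ => ?_
  rw [← PiTensorProduct.map_comp]
  refine Eq.trans ?_ (PiTensorProduct.map_comp _ _)
  congr 1
  funext t
  by_cases ht : t = s
  · subst ht
    simp [h]
  · simp [ht]

lemma powCoeff_zero (V : DivPow k d) (E : V.carrier →ₗ[k] V.carrier) :
    powCoeff 0 LinearMap.id E = 𝟙 V := by
  apply Subtype.ext
  change ∑ S ∈ Finset.powersetCard 0 (Finset.univ : Finset (Fin d)), _ = LinearMap.id
  rw [Finset.powersetCard_zero, Finset.sum_singleton, Finset.piecewise_empty,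
    PiTensorProduct.map_id]

/-- The divided power relation `E · E^{(m)} = (m + 1) E^{(m + 1)}`. An additional `E` in an occupied
slot gives `E² = 0`; in a free slot it enlarges the set of occupied slots, and each set of size `m +
1` arises in `m + 1` ways. -/
lemma powCoeff_comp_derivHom {V : DivPow k d} (E : V.carrier →ₗ[k] V.carrier) (hE : E ∘ₗ E = 0)
    (m : ℕ) :
    powCoeff (W := V) m LinearMap.id E ≫ derivHom E =
      ((m + 1 : ℕ) : k) • powCoeff (V := V) (W := V) (m + 1) LinearMap.id E := by
  apply Subtype.ext
  have h1 : (((m + 1 : ℕ) : k) • powCoeff (V := V) (W := V) (m + 1) LinearMap.id E).1 =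
      ∑ S ∈ Finset.powersetCard (m + 1) (Finset.univ : Finset (Fin d)), ∑ _s ∈ S,
        PiTensorProduct.map (S.piecewise (fun _ => E) fun _ => LinearMap.id) := by
    change ((m + 1 : ℕ) : k) • ∑ S ∈ Finset.powersetCard (m + 1) (Finset.univ : Finset (Fin d)),
      PiTensorProduct.map (S.piecewise (fun _ => E) fun _ => LinearMap.id) = _
    rw [Finset.smul_sum]
    refine Finset.sum_congr rfl fun S hS => ?_
    rw [Finset.sum_const, (Finset.mem_powersetCard.1 hS).2, Nat.cast_smul_eq_nsmul]
  rw [h1]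
  rw [coe_comp, coe_derivHom, coe_powCoeff, comp_sum_linearMap]
  have h2 : ∀ S ∈ Finset.powersetCard m (Finset.univ : Finset (Fin d)),
      (∑ s : Fin d, PiTensorProduct.map (Function.update (fun _ => LinearMap.id) s E)) ∘ₗ
        PiTensorProduct.map (S.piecewise (fun _ => E) fun _ => LinearMap.id) =
      ∑ s ∈ Sᶜ, PiTensorProduct.map ((insert s S).piecewise (fun _ => E)
        fun _ => (LinearMap.id : V.carrier →ₗ[k] V.carrier)) := by
    intro S _
    rw [sum_comp_linearMap, ← Finset.sum_subset (Finset.subset_univ Sᶜ)]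
    · refine Finset.sum_congr rfl fun s hs => ?_
      rw [← PiTensorProduct.map_comp]
      congr 1
      funext t
      by_cases ht : t = s
      · subst ht
        simp [Finset.mem_compl.1 hs]
      · by_cases htS : t ∈ S <;> simp [ht, htS]
    · intro s _ hs
      rw [← PiTensorProduct.map_comp]
      apply map_eq_zero_of_eq_zero _ s
      have : s ∈ S := by simpa using hs
      simp [this, hE]
  rw [Finset.sum_congr rfl h2, Finset.sum_sigma', Finset.sum_sigma']
  -- Pairs of an `m`-set and a point outside it correspond to pairs of an `(m + 1)`-set and a point
  -- inside it.
  refine Finset.sum_bij' (fun a _ => ⟨insert a.2 a.1, a.2⟩) (fun a _ => ⟨a.1.erase a.2, a.2⟩)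
    ?_ ?_ ?_ ?_ ?_
  · rintro ⟨S, s⟩ h
    simp only [Finset.mem_sigma, Finset.mem_powersetCard, Finset.subset_univ, true_and,
      Finset.mem_compl] at h ⊢
    exact ⟨by rw [Finset.card_insert_of_notMem h.2, h.1], Finset.mem_insert_self _ _⟩
  · rintro ⟨S, s⟩ h
    simp only [Finset.mem_sigma, Finset.mem_powersetCard, Finset.subset_univ, true_and,
      Finset.mem_compl] at h ⊢
    exact ⟨by rw [Finset.card_erase_of_mem h.2, h.1, Nat.add_sub_cancel],
      Finset.notMem_erase _ _⟩
  · rintro ⟨S, s⟩ h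
    simp only [Finset.mem_sigma, Finset.mem_compl] at h
    simp [Finset.erase_insert h.2]
  · rintro ⟨S, s⟩ h
    simp only [Finset.mem_sigma] at h
    simp [Finset.insert_erase h.2]
  · rintro ⟨S, s⟩ _
    rfl

lemma powHom_comp_powCoeff {U V W : DivPow k d} (m : ℕ) (f : U.carrier →ₗ[k] V.carrier)
    (g h : V.carrier →ₗ[k] W.carrier) :
    powHom (W := V) f ≫ powCoeff (W := W) m g h = powCoeff m (g ∘ₗ f) (h ∘ₗ f) := by
  apply Subtype.ext
  rw [coe_comp, coe_powCoeff, coe_powCoeff, coe_powHom, sum_comp_linearMap]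
  refine Finset.sum_congr rfl fun S _ => ?_
  rw [← PiTensorProduct.map_comp]
  congr 1
  funext s
  by_cases hs : s ∈ S <;> simp [hs]

lemma powCoeff_comp_powHom {U V W : DivPow k d} (m : ℕ) (g h : U.carrier →ₗ[k] V.carrier)
    (f : V.carrier →ₗ[k] W.carrier) :
    powCoeff (W := V) m g h ≫ powHom (W := W) f = powCoeff m (f ∘ₗ g) (f ∘ₗ h) := by
  apply Subtype.ext
  rw [coe_comp, coe_powCoeff, coe_powCoeff, coe_powHom, comp_sum_linearMap]
  refine Finset.sum_congr rfl fun S _ => ?_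
  rw [← PiTensorProduct.map_comp]
  congr 1
  funext s
  by_cases hs : s ∈ S <;> simp [hs]

end Powers

/-! ### Products of Lie algebra elements and traces -/

section Words

variable {k : Type u} [CommRing k] {d : ℕ}

/-- The product of the endomorphisms `derivHom (F i)`. -/
def wordHom {V : DivPow k d} : ∀ {r : ℕ}, (Fin r → (V.carrier →ₗ[k] V.carrier)) → (V ⟶ V)
  | 0, _ => 𝟙 V
  | _ + 1, F => wordHom (Fin.tail F) ≫ derivHom (F 0)

/-- The product of those `F i` with `f i = s`. -/
def slotProd {V : Type u} [AddCommGroup V] [Module k V] : ∀ {r : ℕ}, (Fin r → (V →ₗ[k] V)) →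
    (Fin r → Fin d) → Fin d → (V →ₗ[k] V)
  | 0, _, _, _ => LinearMap.id
  | _ + 1, F, f, s =>
    (if s = f 0 then F 0 else LinearMap.id) ∘ₗ slotProd (Fin.tail F) (Fin.tail f) s

lemma slotProd_of_notMem {V : Type u} [AddCommGroup V] [Module k V] {r : ℕ}
    (F : Fin r → (V →ₗ[k] V)) (f : Fin r → Fin d) (s : Fin d) (hs : ∀ i, f i ≠ s) :
    slotProd F f s = LinearMap.id := by
  induction r with
  | zero => rfl
  | succ r ih =>
    rw [slotProd, if_neg (hs 0).symm, ih (Fin.tail F) (Fin.tail f) fun i => hs i.succ]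
    rfl

lemma slotProd_perm {V : Type u} [AddCommGroup V] [Module k V] {r : ℕ}
    (F : Fin r → (V →ₗ[k] V)) (f : Fin r → Fin d) (σ : Equiv.Perm (Fin d)) (s : Fin d) :
    slotProd F (σ • f) s = slotProd F f (σ.symm s) := by
  induction r with
  | zero => rfl
  | succ r ih =>
    rw [slotProd, slotProd]
    congr 1
    · simp [Equiv.symm_apply_eq]
    · exact ih (Fin.tail F) (Fin.tail f)

/-- Each factor acts on one slot at a time; `f` records which slot each factor chooses. -/
lemma wordHom_eq_sum {V : DivPow k d} {r : ℕ} (F : Fin r → (V.carrier →ₗ[k] V.carrier)) :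
    (wordHom F).1 = ∑ f : Fin r → Fin d, PiTensorProduct.map (slotProd F f) := by
  induction r with
  | zero =>
    rw [Fintype.sum_unique]
    exact PiTensorProduct.map_id.symm
  | succ r ih =>
    have h1 : (wordHom F).1 = (derivHom (F 0)).1 ∘ₗ (wordHom (Fin.tail F)).1 := rfl
    rw [h1, ih, ← Fintype.sum_equiv (Fin.consEquiv fun _ : Fin (r + 1) => Fin d) _ _ (fun _ => rfl),
      Fintype.sum_prod_type]
    rw [coe_derivHom, sum_comp_linearMap]
    refine Finset.sum_congr rfl fun s _ => ?_
    rw [comp_sum_linearMap]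
    refine Finset.sum_congr rfl fun f _ => ?_
    rw [← PiTensorProduct.map_comp]
    congr 1
    funext t
    simp only [Fin.consEquiv, Equiv.coe_fn_mk, slotProd, Fin.cons_zero, Fin.tail_cons]
    by_cases ht : t = s
    · subst ht
      simp
    · simp [ht]

/-- The sum is split into orbits: free orbits contribute elements of `N`, and all terms of the other
orbits vanish, since having a nontrivial stabilizer is invariant under the action. -/
lemma sum_mem_of_free {G S A : Type*} [Group G] [Fintype G] [MulAction G S] [Fintype S]
    [AddCommMonoid A] (t : S → A) (N : AddSubmonoid A)
    (hN : ∀ x : S, (∀ g : G, g • x = x → g = 1) → ∑ g : G, t (g • x) ∈ N)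
    (h0 : ∀ x : S, (∃ g : G, g • x = x ∧ g ≠ 1) → t x = 0) : ∑ x, t x ∈ N := by
  classical
  rw [← Finset.sum_fiberwise Finset.univ
    (fun x : S => (Quotient.mk (MulAction.orbitRel G S) x)) t]
  refine N.sum_mem fun ω _ => ?_
  induction ω using Quotient.inductionOn with
  | h x =>
    by_cases hx : ∀ g : G, g • x = x → g = 1
    · convert hN x hx using 1
      symm
      refine Finset.sum_bij (fun g _ => g • x) ?_ ?_ ?_ ?_
      · intro g _
        simp only [Finset.mem_filter, Finset.mem_univ, true_and]
        exact Quotient.sound (MulAction.orbitRel_apply.2 ⟨g, rfl⟩)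
      · intro g _ g' _ h
        have := hx (g'⁻¹ * g) (by rw [mul_smul, h, inv_smul_smul])
        rwa [inv_mul_eq_one, eq_comm] at this
      · intro y hy
        simp only [Finset.mem_filter, Finset.mem_univ, true_and] at hy
        obtain ⟨g, hg⟩ := MulAction.orbitRel_apply.1 (Quotient.exact hy)
        exact ⟨g, Finset.mem_univ _, hg⟩
      · intro g _
        rfl
    · push Not at hx
      obtain ⟨g, hg, hg1⟩ := hx
      rw [Finset.sum_eq_zero]
      · exact N.zero_mem
      · intro y hy
        simp only [Finset.mem_filter, Finset.mem_univ, true_and] at hy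
        obtain ⟨a, rfl⟩ := MulAction.orbitRel_apply.1 (Quotient.exact hy)
        refine h0 _ ⟨a * g * a⁻¹, ?_, ?_⟩
        · simp [mul_smul, hg]
        · simpa using hg1

/-- An empty slot contributes the factor `q ∘ i = 0`, so only surjective distributions of the
factors to slots matter. On these `S_d` acts freely, and each orbit sum is a trace. -/
lemma powHom_wordHom_mem_range_trace {U V W : DivPow k d} {r : ℕ}
    (F : Fin r → (V.carrier →ₗ[k] V.carrier)) (i : U.carrier →ₗ[k] V.carrier)
    (q : V.carrier →ₗ[k] W.carrier) (h : q ∘ₗ i = 0) :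
    ∃ φ, powHom i ≫ wordHom F ≫ powHom q = trace U W φ := by
  have h1 : (powHom i ≫ wordHom F ≫ powHom q).1 =
      ∑ f : Fin r → Fin d, PiTensorProduct.map (fun s => q ∘ₗ slotProd F f s ∘ₗ i) := by
    change (PiTensorProduct.map (fun _ => q) ∘ₗ (wordHom F).1) ∘ₗ
      PiTensorProduct.map (fun _ => i) = _
    rw [wordHom_eq_sum, comp_sum_linearMap, sum_comp_linearMap]
    refine Finset.sum_congr rfl fun f _ => ?_
    rw [← PiTensorProduct.map_comp, ← PiTensorProduct.map_comp]
    rfl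
  have h2 : (powHom i ≫ wordHom F ≫ powHom q).1 ∈
      ((LinearMap.range (trace U W)).map
        (gammaHom k d U.carrier W.carrier).subtype).toAddSubmonoid := by
    rw [h1]
    refine sum_mem_of_free (G := Equiv.Perm (Fin d)) _ _ ?_ ?_
    · intro f _
      -- The sum over the orbit of `f` is the trace of the summand at `f`, as conjugation by `σ`
      -- permutes the slots.
      refine ⟨_, ⟨PiTensorProduct.map (fun s => q ∘ₗ slotProd F f s ∘ₗ i), rfl⟩, ?_⟩
      refine LinearMap.ext fun x => ?_
      refine (trace_apply _ _).trans ?_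
      rw [LinearMap.sum_apply]
      refine Finset.sum_congr rfl fun σ _ => ?_
      simp only [slotProd_perm]
      rw [← LinearMap.comp_apply, perm_comp_map, LinearMap.comp_apply, perm_perm]
      simp [perm_one]
    · rintro f ⟨σ, hσ, hσ1⟩
      -- A permutation fixing `f` fixes every slot in its image, so a nontrivial stabilizer forces
      -- an empty slot.
      obtain ⟨s, hs⟩ : ∃ s, ∀ j, f j ≠ s := by
        by_contra! hf
        apply hσ1
        ext s
        obtain ⟨j, rfl⟩ := hf s
        exact congrArg Fin.val (congrFun hσ j)
      apply map_eq_zero_of_eq_zero _ s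
      rw [slotProd_of_notMem F f s hs, LinearMap.id_comp, h]
  obtain ⟨_, ⟨φ, rfl⟩, hφ⟩ := h2
  exact ⟨φ, Subtype.ext hφ.symm⟩

end Words

end StrictPoly

namespace StrictPoly

/-! ### The span under the Lie algebra and the matrices preserving it -/

section LieSpan

variable {k : Type u} [CommRing k] {d : ℕ} (X : RepGamma k d)

/-- The subspace of `X (V)` generated by `x` under the action of the Lie algebra `𝔤𝔩 (V)`. -/
def lieSpan {V : DivPow k d} (x : X.obj.obj V) : Submodule k (X.obj.obj V) :=
  Submodule.span k {y | ∃ (r : ℕ) (F : Fin r → (V.carrier →ₗ[k] V.carrier)),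
    act X (wordHom F) x = y}

variable {X}

lemma mem_lieSpan_self {V : DivPow k d} (x : X.obj.obj V) : x ∈ lieSpan X x :=
  Submodule.subset_span ⟨0, Fin.elim0, act_id X x⟩

lemma derivHom_mem_lieSpan {V : DivPow k d} {x y : X.obj.obj V}
    (F : V.carrier →ₗ[k] V.carrier) (hy : y ∈ lieSpan X x) :
    act X (derivHom F) y ∈ lieSpan X x := by
  induction hy using Submodule.span_induction with
  | mem y hy =>
    obtain ⟨r, G, rfl⟩ := hy
    refine Submodule.subset_span ⟨r + 1, Fin.cons F G, ?_⟩
    rw [← act_comp]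
    rfl
  | zero => rw [map_zero]; exact Submodule.zero_mem _
  | add y z _ _ hy hz => rw [map_add]; exact Submodule.add_mem _ hy hz
  | smul c y _ hy => rw [map_smul]; exact Submodule.smul_mem _ c hy

/-- The linear endomorphisms `g` of `V` for which `g^{⊗ d}` preserves `lieSpan X x`. -/
def lieStabilizer {V : DivPow k d} (x : X.obj.obj V) : Submonoid (Module.End k V.carrier) where
  carrier := {g | ∀ y ∈ lieSpan X x, act X (powHom g) y ∈ lieSpan X x}
  one_mem' := fun y hy => by
    rw [Module.End.one_eq_id, powHom_id, act_id]
    exact hy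
  mul_mem' := fun {g h} hg hh y hy => by
    rw [Module.End.mul_eq_comp, ← powHom_comp, act_comp]
    exact hg _ (hh _ hy)

/-- Since `g` normalizes the Lie algebra, it can be moved past every factor of a product, at the
cost of conjugating that factor; only its effect on the generator `x` is left to check. -/
lemma mem_lieStabilizer_of_mem {V : DivPow k d} {x : X.obj.obj V}
    (g g' : Module.End k V.carrier) (hg : g' * g = 1)
    (h : act X (powHom g) x ∈ lieSpan X x) : g ∈ lieStabilizer x := by
  intro y hy
  induction hy using Submodule.span_induction with
  | mem y hy =>
    obtain ⟨r, F, rfl⟩ := hy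
    induction r with
    | zero =>
      have : act X (wordHom F) x = x := act_id X x
      rwa [this]
    | succ r ih =>
      rw [wordHom, act_comp, ← act_comp, derivHom_comp_powHom (F 0) (g * F 0 * g') g, act_comp]
      · exact derivHom_mem_lieSpan _ (ih _)
      · change g * F 0 = g * F 0 * g' * g
        rw [mul_assoc _ g' g, hg, mul_one]
  | zero => rw [map_zero]; exact Submodule.zero_mem _
  | add y z _ _ hy hz => rw [map_add]; exact Submodule.add_mem _ hy hz
  | smul c y _ hy => rw [map_smul]; exact Submodule.smul_mem _ c hy

/-- As `F E = 0`, the Lie bracket of `E` and `F` is `E F`, and the group commutator of `1 + c E` and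
`1 + F` is exactly `1 + c E F`. -/
lemma one_add_smul_comm_mem {V : DivPow k d} {x : X.obj.obj V} {E F : Module.End k V.carrier}
    (hE : E * E = 0) (hF : F * F = 0) (hFE : F * E = 0)
    (hE' : ∀ c : k, 1 + c • E ∈ lieStabilizer x) (hF' : ∀ c : k, 1 + c • F ∈ lieStabilizer x)
    (c : k) : 1 + c • (E * F) ∈ lieStabilizer x := by
  have h : 1 + c • (E * F) = (1 + c • E) * (1 + (1 : k) • F) * (1 + (-c) • E) *
      (1 + (-1 : k) • F) := by
    have h1 : E * F * E = 0 := by rw [mul_assoc, hFE, mul_zero]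
    have h2 : E * F * F = 0 := by rw [mul_assoc, hF, mul_zero]
    simp only [mul_add, add_mul, one_mul, mul_one, smul_mul_assoc, mul_smul_comm, hE, hF, hFE,
      h1, h2, smul_zero, add_zero]
    module
  rw [h]
  exact mul_mem (mul_mem (mul_mem (hE' _) (hF' _)) (hE' _)) (hF' _)

end LieSpan

/-! ### Divided powers in characteristic `p`, and traces over a field -/

section Field

variable {k : Type u} [Field k] {d : ℕ} {X : RepGamma k d}

/-- In the expansion of `(1 + c E)^{⊗ d}` into divided powers, those of exponent below `p` come from
the Lie algebra because `m!` is invertible, and the remaining ones kill `x`. -/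
lemma one_add_smul_mem_lieStabilizer {p : ℕ} [Fact p.Prime] [CharP k p] {V : DivPow k d}
    {x : X.obj.obj V} {E : Module.End k V.carrier} (hE : E * E = 0)
    (h : ∀ m, p ≤ m → act X (powCoeff m LinearMap.id E : V ⟶ V) x = 0) (c : k) :
    1 + c • E ∈ lieStabilizer x := by
  refine mem_lieStabilizer_of_mem _ (1 + (-c) • E) ?_ ?_
  · simp only [mul_add, add_mul, one_mul, mul_one, smul_mul_assoc, mul_smul_comm, hE, smul_zero,
      add_zero]
    module
  · have key : ∀ m, act X (powCoeff m LinearMap.id E : V ⟶ V) x ∈ lieSpan X x := by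
      intro m
      induction m with
      | zero =>
        rw [powCoeff_zero, act_id]
        exact mem_lieSpan_self x
      | succ m ih =>
        by_cases hm : p ≤ m + 1
        · rw [h _ hm]
          exact Submodule.zero_mem _
        · have hne : ((m + 1 : ℕ) : k) ≠ 0 := by
            rw [Ne, CharP.cast_eq_zero_iff k p]
            exact fun hd => hm (Nat.le_of_dvd m.succ_pos hd)
          have h1 := derivHom_mem_lieSpan E ih
          rw [← act_comp, powCoeff_comp_derivHom E hE, act_smul] at h1
          exact (Submodule.smul_mem_iff _ hne).1 h1
    rw [Module.End.one_eq_id, powHom_add_smul, act_sum]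
    refine Submodule.sum_mem _ fun m _ => ?_
    rw [act_smul]
    exact Submodule.smul_mem _ _ (key m)

/-- A linear map between finite-dimensional spaces is a sum of maps of rank one. -/
lemma act_trace_of_weightSpace (h : weightSpace X d (fun _ => 1) = ⊥) {V W : DivPow k d}
    (φ : (⨂[k]^d V.carrier) →ₗ[k] (⨂[k]^d W.carrier)) : act X (trace V W φ) = 0 := by
  let b := Basis.piTensorProduct (fun _ : Fin d => Module.finBasis k V.carrier)
  have h1 : φ = ∑ i, (b.coord i).smulRight (φ (b i)) := by
    apply b.ext
    intro j
    rw [LinearMap.sum_apply, Finset.sum_eq_single j]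
    · simp
    · intro i _ hi
      simp [hi.symm]
    · simp
  ext1 x
  rw [h1, map_sum, act_sum]
  simp only [LinearMap.zero_apply]
  refine Finset.sum_eq_zero fun i _ => ?_
  exact congrArg (fun f : X.obj.obj V →ₗ[k] X.obj.obj W => f x)
    (act_rankOne_of_weightSpace h (b.coord i) (φ (b i)))

lemma act_powHom_lieSpan (h : weightSpace X d (fun _ => 1) = ⊥) {U V W : DivPow k d}
    (i : U.carrier →ₗ[k] V.carrier) (q : V.carrier →ₗ[k] W.carrier) (hq : q ∘ₗ i = 0)
    (v : X.obj.obj U) {y : X.obj.obj V} (hy : y ∈ lieSpan X (act X (powHom i) v)) :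
    act X (powHom q : V ⟶ W) y = 0 := by
  induction hy using Submodule.span_induction with
  | mem y hy =>
    obtain ⟨r, F, rfl⟩ := hy
    obtain ⟨φ, hφ⟩ := powHom_wordHom_mem_range_trace F i q hq
    rw [← act_comp, ← act_comp, hφ, act_trace_of_weightSpace h]
    simp
  | zero => rw [map_zero]
  | add y z _ _ hy hz => rw [map_add, hy, hz, add_zero]
  | smul c y _ hy => rw [map_smul, hy, smul_zero]

end Field

/-! ### Weights under matrix units and permutation matrices -/

section Weights

variable {k : Type u} [CommRing k] {d : ℕ}

variable (k d) in
/-- The standard basis vector `e_i` of the object `k^n` of `Γ^d P_k`. -/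
def stdVec {n : ℕ} (i : Fin n) : (stdObj k d n).carrier := (Pi.single i 1 : Fin n → k)

/-- The coordinates on the object `k^n` of `Γ^d P_k`. -/
def stdCoord {n : ℕ} (j : Fin n) : (stdObj k d n).carrier →ₗ[k] k :=
  (LinearMap.proj j : (Fin n → k) →ₗ[k] k)

lemma stdCoord_stdVec {n : ℕ} (i j : Fin n) :
    stdCoord j (stdVec k d i) = if i = j then (1 : k) else 0 := by
  have h : stdCoord j (stdVec k d i) = (Pi.single i 1 : Fin n → k) j := rfl
  rw [h, Pi.single_apply]
  simp only [eq_comm]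

lemma stdBasis_eq_tprod {n : ℕ} (q : Fin d → Fin n) :
    stdBasis k d n q = PiTensorProduct.tprod k fun s => stdVec k d (q s) := by
  refine (Basis.piTensorProduct_apply _ _).trans ?_
  congr 1
  funext s
  exact Pi.basisFun_apply k (Fin n) (q s)

lemma map_stdBasis {n : ℕ} {W : Type u} [AddCommGroup W] [Module k W]
    (f : Fin d → (stdObj k d n).carrier →ₗ[k] W) (q : Fin d → Fin n) :
    PiTensorProduct.map f (stdBasis k d n q) =
      PiTensorProduct.tprod k fun s => f s (stdVec k d (q s)) := by
  rw [stdBasis_eq_tprod, PiTensorProduct.map_tprod]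

/-- To survive, `h` must meet `e_j` in `m` different slots, but a basis vector of weight `μ` has
only `μ j` slots with `e_j`. -/
lemma weightIdem_comp_powCoeff {n : ℕ} {W : DivPow k d} (μ : Fin n → ℕ) (m : ℕ) (j : Fin n)
    (hm : μ j < m) (g h : (stdObj k d n).carrier →ₗ[k] W.carrier)
    (hh : ∀ i, i ≠ j → h (stdVec k d i) = 0) :
    weightIdem k d n μ ≫ powCoeff (W := W) m g h = 0 := by
  apply Subtype.ext
  apply (stdBasis k d n).ext
  intro q
  rw [coe_comp, LinearMap.comp_apply, weightIdem_stdBasis]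
  split_ifs with hq
  · rw [coe_powCoeff, LinearMap.sum_apply]
    refine Finset.sum_eq_zero fun S hS => ?_
    obtain ⟨s, hs, hsj⟩ : ∃ s ∈ S, q s ≠ j := by
      by_contra! hc
      have h1 : S ⊆ Finset.univ.filter fun i => q i = j := fun s hs => by simpa using hc s hs
      have h2 := Finset.card_le_card h1
      rw [(Finset.mem_powersetCard.1 hS).2] at h2
      have h3 : (Finset.univ.filter fun i => q i = j).card = μ j := congrFun hq j
      omega
    rw [map_stdBasis]
    apply MultilinearMap.map_coord_zero _ s
    rw [Finset.piecewise_eq_of_mem _ _ _ hs]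
    exact hh _ hsj
  · rw [map_zero]
    rfl

/-- The matrix unit `e_i e_j^*`. -/
def matUnit {n : ℕ} (i j : Fin n) : Module.End k (stdObj k d n).carrier :=
  (stdCoord j).smulRight (stdVec k d i)

lemma matUnit_stdVec {n : ℕ} (i j l : Fin n) :
    matUnit i j (stdVec k d l) = if l = j then stdVec k d i else 0 := by
  rw [matUnit, LinearMap.smulRight_apply, stdCoord_stdVec, ite_smul, one_smul, zero_smul]

lemma matUnit_mul_matUnit {n : ℕ} (i j i' j' : Fin n) :
    (matUnit i j * matUnit i' j' : Module.End k (stdObj k d n).carrier) =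
      if i' = j then matUnit i j' else 0 := by
  refine LinearMap.ext fun x => ?_
  have h : matUnit i' j' x = stdCoord j' x • stdVec k d i' := rfl
  rw [Module.End.mul_apply, h, map_smul, matUnit_stdVec]
  split_ifs
  · rfl
  · rw [smul_zero]
    rfl

lemma sum_matUnit (n : ℕ) : ∑ i, matUnit i i = (1 : Module.End k (stdObj k d n).carrier) := by
  refine LinearMap.ext fun x => ?_
  rw [LinearMap.sum_apply]
  exact (pi_eq_sum_univ' (x : Fin n → k)).symm

/-- The permutation matrix of `τ`. -/
def permMat {n : ℕ} (τ : Equiv.Perm (Fin n)) : Module.End k (stdObj k d n).carrier :=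
  LinearMap.funLeft k k τ

lemma permMat_stdVec {n : ℕ} (τ : Equiv.Perm (Fin n)) (i : Fin n) :
    permMat τ (stdVec k d i) = stdVec k d (τ.symm i) := by
  refine funext fun j => ?_
  change (Pi.single i 1 : Fin n → k) (τ j) = (Pi.single (τ.symm i) 1 : Fin n → k) j
  simp only [Pi.single_apply, Equiv.eq_symm_apply]

lemma permMat_mul_permMat_symm {n : ℕ} (τ : Equiv.Perm (Fin n)) :
    permMat τ.symm * permMat τ = (1 : Module.End k (stdObj k d n).carrier) := by
  refine LinearMap.ext fun f => funext fun i => ?_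
  change (f : Fin n → k) (τ (τ.symm i)) = (f : Fin n → k) i
  rw [τ.apply_symm_apply]

/-- The divided power of exponent `m` replaces `m` of the letters `e_j` by `e_i`, so it carries
weight `μ` to weight `ν`. -/
lemma weightIdem_comp_powCoeff_matUnit {n : ℕ} (μ ν : Fin n → ℕ) (m : ℕ) (i j : Fin n)
    (hij : i ≠ j) (hj : μ j = ν j + m) (hi : ν i = μ i + m)
    (h : ∀ l, l ≠ i → l ≠ j → ν l = μ l) :
    weightIdem k d n μ ≫ powCoeff m LinearMap.id (matUnit i j) ≫ weightIdem k d n ν =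
      weightIdem k d n μ ≫ powCoeff m LinearMap.id (matUnit i j) := by
  apply Subtype.ext
  apply (stdBasis k d n).ext
  intro q
  rw [coe_comp, coe_comp, coe_comp, LinearMap.comp_apply, LinearMap.comp_apply,
    LinearMap.comp_apply, weightIdem_stdBasis]
  split_ifs with hq
  · rw [coe_powCoeff, LinearMap.sum_apply, map_sum]
    refine Finset.sum_congr rfl fun S hS => ?_
    by_cases hSj : ∀ s ∈ S, q s = j
    · have h1 : PiTensorProduct.map
          (S.piecewise (fun _ => matUnit (k := k) (d := d) i j) fun _ => LinearMap.id)
          (stdBasis k d n q) = stdBasis k d n (S.piecewise (fun _ => i) q) := by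
        rw [map_stdBasis, stdBasis_eq_tprod]
        congr 1
        funext s
        by_cases hs : s ∈ S
        · rw [Finset.piecewise_eq_of_mem _ _ _ hs, Finset.piecewise_eq_of_mem _ _ _ hs,
            matUnit_stdVec, if_pos (hSj s hs)]
        · rw [Finset.piecewise_eq_of_notMem _ _ _ hs, Finset.piecewise_eq_of_notMem _ _ _ hs]
          rfl
      rw [h1, weightIdem_stdBasis, if_pos]
      have hcard : S.card = m := (Finset.mem_powersetCard.1 hS).2
      funext l
      have hl : (Finset.univ.filter fun s => q s = l).card = μ l := congrFun hq l
      rw [content]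
      by_cases hli : l = i
      · subst hli
        have h2 : (Finset.univ.filter fun s => S.piecewise (fun _ => l) q s = l) =
            S ∪ Finset.univ.filter fun s => q s = l := by
          ext s
          by_cases hs : s ∈ S <;> simp [hs]
        rw [h2, Finset.card_union_of_disjoint, hcard, hl, hi, add_comm]
        rw [Finset.disjoint_left]
        intro s hs
        simpa [hSj s hs] using hij.symm
      · by_cases hlj : l = j
        · subst hlj
          have h2 : (Finset.univ.filter fun s => S.piecewise (fun _ => i) q s = l) =
              (Finset.univ.filter fun s => q s = l) \ S := by
            ext s
            by_cases hs : s ∈ S <;> simp [hs, hij]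
          rw [h2, Finset.card_sdiff_of_subset (fun s hs => by simpa using hSj s hs), hcard, hl, hj,
            Nat.add_sub_cancel]
        · have h2 : (Finset.univ.filter fun s => S.piecewise (fun _ => i) q s = l) =
              Finset.univ.filter fun s => q s = l := by
            ext s
            by_cases hs : s ∈ S
            · simp [hs, hSj s hs, Ne.symm hli, Ne.symm hlj]
            · simp [hs]
          rw [h2, hl, h l hli hlj]
    · push Not at hSj
      obtain ⟨s, hs, hsj⟩ := hSj
      have h1 : PiTensorProduct.map
          (S.piecewise (fun _ => matUnit (k := k) (d := d) i j) fun _ => LinearMap.id)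
          (stdBasis k d n q) = 0 := by
        rw [map_stdBasis]
        apply MultilinearMap.map_coord_zero _ s
        rw [Finset.piecewise_eq_of_mem _ _ _ hs, matUnit_stdVec, if_neg hsj]
      rw [h1, map_zero]
  · simp

lemma weightIdem_comp_powHom_permMat {n : ℕ} (μ : Fin n → ℕ) (τ : Equiv.Perm (Fin n)) :
    weightIdem k d n μ ≫ powHom (permMat τ) = powHom (permMat τ) ≫ weightIdem k d n (μ ∘ τ) := by
  apply Subtype.ext
  apply (stdBasis k d n).ext
  intro q
  have h1 : (powHom (permMat τ) : stdObj k d n ⟶ stdObj k d n).1 (stdBasis k d n q) =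
      stdBasis k d n (τ.symm ∘ q) := by
    rw [coe_powHom, map_stdBasis, stdBasis_eq_tprod]
    simp only [permMat_stdVec, Function.comp_apply]
  have h2 : content (τ.symm ∘ q) = μ ∘ τ ↔ content q = μ := by
    have h3 : content (τ.symm ∘ q) = content q ∘ τ := by
      funext j
      simp only [content, Function.comp_apply, Equiv.symm_apply_eq]
    rw [h3]
    exact τ.surjective.injective_comp_right.eq_iff
  rw [coe_comp, coe_comp, LinearMap.comp_apply, LinearMap.comp_apply, h1, weightIdem_stdBasis,
    weightIdem_stdBasis]
  simp only [h2]
  split_ifs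
  · rw [h1]
  · rw [map_zero]

/-- The set of weights is symmetric under the Weyl group, realized by permutation matrices. -/
lemma weightSpace_eq_bot_of_perm {X : RepGamma k d} {n : ℕ} {μ : Fin n → ℕ}
    (τ : Equiv.Perm (Fin n)) (h : weightSpace X n (μ ∘ τ) = ⊥) : weightSpace X n μ = ⊥ := by
  rw [weightSpace_eq_bot_iff] at h ⊢
  ext1 x
  have h1 : (powHom (permMat τ) : stdObj k d n ⟶ stdObj k d n) ≫ powHom (permMat τ.symm) =
      𝟙 (stdObj k d n) := by
    rw [powHom_comp, ← Module.End.mul_eq_comp, permMat_mul_permMat_symm, Module.End.one_eq_id,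
      powHom_id]
  rw [← act_id X (act X (weightIdem k d n μ) x), ← h1, ← act_comp, ← Category.assoc,
    weightIdem_comp_powHom_permMat, act_comp, act_comp, h]
  simp

/-- A vector of restricted highest weight is annihilated by the divided powers of exponent at least
`p` of a simple root vector. -/
lemma act_powCoeff_matUnit_of_isRestricted {X : RepGamma k d} {lam : Fin d → ℕ} {p : ℕ}
    (hlam : IsHighestWeight X lam) (hp : IsRestricted p lam) (i j : Fin d)
    (hij : i.val = j.val + 1) {m : ℕ} (hm : p ≤ m) (v : X.obj.obj (stdObj k d d)) :
    act X (weightIdem k d d lam ≫ powCoeff m LinearMap.id (matUnit i j)) v = 0 := by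
  have hne : i ≠ j := fun h => by rw [h] at hij; omega
  by_cases hmj : lam j < m
  · rw [weightIdem_comp_powCoeff lam m j hmj _ _ fun l hl => by rw [matUnit_stdVec, if_neg hl],
      act_zero]
  · have hres := hp j
    have hi : (⟨j.val + 1, hij ▸ i.isLt⟩ : Fin d) = i := Fin.ext hij.symm
    rw [dif_pos (hij ▸ i.isLt), hi] at hres
    let ν : Fin d → ℕ := fun l => if l = i then lam i + m else if l = j then lam j - m else lam l
    have hνi : ν i = lam i + m := if_pos rfl
    have hνj : ν j = lam j - m := (if_neg hne.symm).trans (if_pos rfl)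
    have hνl : ∀ l, l ≠ i → l ≠ j → ν l = lam l := fun l h1 h2 => (if_neg h1).trans (if_neg h2)
    -- If `ν` were a weight, so would be its transpose under `i` and `j`, whose entry `lam i + m` at
    -- `j` exceeds `lam j` by restrictedness; the partial sum through `j` then contradicts
    -- dominance.
    have hν : weightSpace X d ν = ⊥ := by
      apply weightSpace_eq_bot_of_perm (Equiv.swap i j)
      by_contra hc
      have h1 := hlam.2 _ hc (j.val + 1)
      refine absurd h1 (not_le.2 ?_)
      refine Finset.sum_lt_sum (fun l hl => ?_) ⟨j, by simp, ?_⟩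
      · have hlj : l.val < j.val + 1 := by simpa using hl
        by_cases hl' : l = j
        · subst hl'
          rw [Function.comp_apply, Equiv.swap_apply_right, hνi]
          omega
        · have hli : l ≠ i := fun h => by rw [h] at hlj; omega
          rw [Function.comp_apply, Equiv.swap_apply_of_ne_of_ne hli hl', hνl l hli hl']
      · rw [Function.comp_apply, Equiv.swap_apply_right, hνi]
        omega
    rw [← weightIdem_comp_powCoeff_matUnit lam ν m i j hne (by omega) hνi hνl, act_comp, act_comp,
      weightSpace_eq_bot_iff.1 hν]
    rfl

end Weights

/-! ### Matrix units of `k^d ⊕ k^d` -/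

section Doubling

variable (k : Type u) [CommRing k] (d : ℕ)

/-- The object `k^d × k^d` of `Γ^d P_k`. -/
def dblObj : DivPow k d := ⟨(Fin d → k) × (Fin d → k)⟩

variable {k d}

/-- The inclusion of the first summand of `k^d × k^d`. -/
def dblInl : (stdObj k d d).carrier →ₗ[k] (dblObj k d).carrier :=
  LinearMap.inl k (Fin d → k) (Fin d → k)

/-- The inclusion of the second summand of `k^d × k^d`. -/
def dblInr : (stdObj k d d).carrier →ₗ[k] (dblObj k d).carrier :=
  LinearMap.inr k (Fin d → k) (Fin d → k)

/-- The projection to the first summand of `k^d × k^d`. -/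
def dblFst : (dblObj k d).carrier →ₗ[k] (stdObj k d d).carrier :=
  LinearMap.fst k (Fin d → k) (Fin d → k)

/-- The projection to the second summand of `k^d × k^d`. -/
def dblSnd : (dblObj k d).carrier →ₗ[k] (stdObj k d d).carrier :=
  LinearMap.snd k (Fin d → k) (Fin d → k)

lemma dblFst_dblInl (x : (stdObj k d d).carrier) : dblFst (dblInl x) = x := rfl

lemma dblFst_dblInr (x : (stdObj k d d).carrier) : dblFst (dblInr x) = 0 := rfl

lemma dblSnd_dblInl (x : (stdObj k d d).carrier) : dblSnd (dblInl x) = 0 := rfl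

lemma dblSnd_dblInr (x : (stdObj k d d).carrier) : dblSnd (dblInr x) = x := rfl

/-- The matrix units of `k^d × k^d` within the first summand. -/
def diagUnit (i j : Fin d) : Module.End k (dblObj k d).carrier :=
  dblInl ∘ₗ matUnit i j ∘ₗ dblFst

/-- The matrix units of `k^d × k^d` from the first summand to the second. -/
def offUnit (i j : Fin d) : Module.End k (dblObj k d).carrier :=
  dblInr ∘ₗ matUnit i j ∘ₗ dblFst

lemma diagUnit_apply (i j : Fin d) (z : (dblObj k d).carrier) :
    diagUnit i j z = dblInl (matUnit i j (dblFst z)) := rfl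

lemma offUnit_apply (i j : Fin d) (z : (dblObj k d).carrier) :
    offUnit i j z = dblInr (matUnit i j (dblFst z)) := rfl

lemma diagUnit_mul_diagUnit {i j : Fin d} (h : i ≠ j) :
    diagUnit i j * diagUnit i j = (0 : Module.End k (dblObj k d).carrier) := by
  refine LinearMap.ext fun z => ?_
  rw [Module.End.mul_apply, diagUnit_apply, diagUnit_apply, dblFst_dblInl, ← Module.End.mul_apply,
    matUnit_mul_matUnit, if_neg h, LinearMap.zero_apply, map_zero, LinearMap.zero_apply]

lemma offUnit_mul_offUnit (i j i' j' : Fin d) :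
    offUnit i j * offUnit i' j' = (0 : Module.End k (dblObj k d).carrier) := by
  refine LinearMap.ext fun z => ?_
  rw [Module.End.mul_apply, offUnit_apply, offUnit_apply, dblFst_dblInr, map_zero, map_zero,
    LinearMap.zero_apply]

lemma diagUnit_mul_offUnit (i j i' j' : Fin d) :
    diagUnit i j * offUnit i' j' = (0 : Module.End k (dblObj k d).carrier) := by
  refine LinearMap.ext fun z => ?_
  rw [Module.End.mul_apply, diagUnit_apply, offUnit_apply, dblFst_dblInr, map_zero, map_zero,
    LinearMap.zero_apply]

lemma offUnit_mul_diagUnit (i j l : Fin d) :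
    offUnit i j * diagUnit j l = (offUnit i l : Module.End k (dblObj k d).carrier) := by
  refine LinearMap.ext fun z => ?_
  rw [Module.End.mul_apply, offUnit_apply, diagUnit_apply, dblFst_dblInl, ← Module.End.mul_apply,
    matUnit_mul_matUnit, if_pos rfl, offUnit_apply]

lemma dblSnd_comp_dblInl : dblSnd ∘ₗ dblInl = (0 : Module.End k (stdObj k d d).carrier) := rfl

lemma diagUnit_comp_dblInl (i j : Fin d) :
    (diagUnit i j : Module.End k (dblObj k d).carrier) ∘ₗ dblInl = dblInl ∘ₗ matUnit i j := rfl

lemma dblSnd_comp_one_add_sum_comp_dblInl :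
    dblSnd ∘ₗ (1 + ∑ i, offUnit i i : Module.End k (dblObj k d).carrier) ∘ₗ dblInl =
      LinearMap.id := by
  refine LinearMap.ext fun x => ?_
  rw [LinearMap.comp_apply, LinearMap.comp_apply, LinearMap.add_apply, LinearMap.sum_apply, map_add,
    map_sum, Module.End.one_apply, dblSnd_dblInl, zero_add]
  simp only [offUnit_apply, dblSnd_dblInr, dblFst_dblInl]
  rw [← LinearMap.sum_apply, sum_matUnit]
  rfl

end Doubling

/-! ### Restricted highest weights force the weight (1, …, 1) -/

section Restricted

variable {k : Type u} [Field k] {d : ℕ} {X : RepGamma k d}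

/-- A strict polynomial functor with a `p`-restricted highest weight is not annihilated by the Schur
functor. -/
theorem weightSpace_one_ne_bot_of_isRestricted {p : ℕ} [Fact p.Prime] [CharP k p]
    {lam : Fin d → ℕ} (hlam : IsHighestWeight X lam) (hp : IsRestricted p lam) :
    weightSpace X d (fun _ => 1) ≠ ⊥ := by
  intro hX
  apply hlam.1
  rw [weightSpace_eq_bot_iff]
  ext1 v
  set x : X.obj.obj (dblObj k d) := act X (powHom dblInl) (act X (weightIdem k d d lam) v) with hx
  -- Divided powers of a simple lowering operator commute with the first inclusion, so their
  -- vanishing on `x` is tested on the weight vector in `X (k^d)`.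
  have hdiag : ∀ i j : Fin d, i.val = j.val + 1 → ∀ c : k, 1 + c • diagUnit i j ∈
      lieStabilizer x := by
    intro i j hij
    refine one_add_smul_mem_lieStabilizer (p := p)
      (diagUnit_mul_diagUnit fun h => by rw [h] at hij; omega) fun m hm => ?_
    rw [hx, ← act_comp, powHom_comp_powCoeff, diagUnit_comp_dblInl, LinearMap.id_comp,
      ← LinearMap.comp_id dblInl, LinearMap.comp_assoc, LinearMap.id_comp,
      ← powCoeff_comp_powHom, act_comp, ← act_comp X (weightIdem k d d lam),
      act_powCoeff_matUnit_of_isRestricted hlam hp i j hij hm, map_zero]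
  -- Descending induction on the column `j`, from the last one leftwards.
  have hoff : ∀ t : ℕ, ∀ i j : Fin d, j.val + 1 + t = d → ∀ c : k,
      1 + c • offUnit i j ∈ lieStabilizer x := by
    intro t
    induction t with
    | zero =>
      intro i j hj
      refine one_add_smul_mem_lieStabilizer (p := p) (offUnit_mul_offUnit _ _ _ _) fun m hm => ?_
      -- In the last column restrictedness reads `lam j < p`, by the convention that the next entry
      -- is zero; so there are fewer than `p` letters to move.
      have hres := hp j
      rw [dif_neg (by omega), zero_add] at hres
      rw [hx, ← act_comp, powHom_comp_powCoeff, ← act_comp,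
        weightIdem_comp_powCoeff lam m j (by omega), act_zero]
      intro l hl
      rw [LinearMap.comp_apply, offUnit_apply, dblFst_dblInl, matUnit_stdVec, if_neg hl, map_zero]
    | succ t ih =>
      intro i j hj
      have h1 := ih i ⟨j.val + 1, by omega⟩ (by simp only; omega)
      have h2 := hdiag ⟨j.val + 1, by omega⟩ j rfl
      -- The unit in column `j` is the bracket of the one in column `j + 1` with a simple lowering
      -- operator.
      rw [← offUnit_mul_diagUnit i ⟨j.val + 1, by omega⟩ j]
      exact one_add_smul_comm_mem (offUnit_mul_offUnit _ _ _ _)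
        (diagUnit_mul_diagUnit (fun h => by simp [Fin.ext_iff] at h))
        (diagUnit_mul_offUnit _ _ _ _) h1 h2
  -- Products of the units `offUnit` vanish, so multiplying the matrices `1 + offUnit a a` adds up
  -- their nilpotent parts.
  have hsum : ∀ s : Finset (Fin d), 1 + ∑ i ∈ s, offUnit i i ∈ lieStabilizer x := by
    intro s
    induction s using Finset.induction_on with
    | empty => simp
    | insert a s ha ih =>
      have h1 := hoff (d - 1 - a.val) a a (by omega) 1
      have h2 : 1 + ∑ i ∈ insert a s, offUnit i i =
          ((1 + (1 : k) • offUnit a a) * (1 + ∑ i ∈ s, offUnit i i) :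
            Module.End k (dblObj k d).carrier) := by
        rw [Finset.sum_insert ha, one_smul, add_mul, one_mul, mul_add, mul_one, Finset.mul_sum,
          Finset.sum_eq_zero fun i _ => offUnit_mul_offUnit a a i i, add_zero]
        abel
      rw [h2]
      exact mul_mem h1 ih
  -- The second projection kills the stable span, but along the matrix just built it returns the
  -- weight vector itself.
  have h3 := act_powHom_lieSpan hX dblInl dblSnd dblSnd_comp_dblInl _
    (hsum Finset.univ x (mem_lieSpan_self x))
  rw [hx, ← act_comp, ← act_comp, powHom_comp, powHom_comp] at h3
  rw [LinearMap.comp_assoc, dblSnd_comp_one_add_sum_comp_dblInl, powHom_id, act_id] at h3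
  exact h3

end Restricted

end StrictPoly

namespace StrictPoly

/-! ### The weight (1, …, 1) of an internal tensor product -/

section TensorValue

variable {k : Type u} [CommRing k] {d : ℕ}

/-- The generators of `(X ⊗ Y)(U)` as a trilinear map. -/
def tensorMkHom (X Y : RepGamma k d) (V W U : DivPow k d) :
    (V.tensorObj W ⟶ U) →ₗ[k] X.obj.obj V →ₗ[k] Y.obj.obj W →ₗ[k] TensorVal X Y U :=
  have hs : ∀ (t : Gen X Y U) (r : k),
      (Submodule.Quotient.mk (.single t r) : TensorVal X Y U) = r • tensorMk t := fun t r => by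
    rw [tensorMk, ← Submodule.Quotient.mk_smul, Finsupp.smul_single, smul_eq_mul, mul_one]
  LinearMap.mk₂ k (fun h x =>
    { toFun := fun y => tensorMk ⟨V, W, h, x, y⟩
      map_add' := fun y y' => tensorMk_eq (Relator.add_y V W h x y y')
      map_smul' := fun r y => (tensorMk_eq (Relator.smul_y V W r h x y)).trans (hs _ r) })
    (fun h h' x => LinearMap.ext fun y => tensorMk_eq (Relator.add_h V W h h' x y))
    (fun r h x => LinearMap.ext fun y =>
      (tensorMk_eq (Relator.smul_h V W r h x y)).trans (hs _ r))
    (fun h x x' => LinearMap.ext fun y => tensorMk_eq (Relator.add_x V W h x x' y))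
    (fun r h x => LinearMap.ext fun y =>
      (tensorMk_eq (Relator.smul_x V W r h x y)).trans (hs _ r))

lemma tensorMkHom_tensorHom {X Y : RepGamma k d} {V V' W W' U : DivPow k d} (f : V ⟶ V')
    (g : W ⟶ W') (h : V'.tensorObj W' ⟶ U) (x : X.obj.obj V) (y : Y.obj.obj W) :
    tensorMkHom X Y V W U (DivPow.tensorHom f g ≫ h) x y =
      tensorMkHom X Y V' W' U h (act X f x) (act Y g y) :=
  tensorMk_eq (Relator.nat f g h x y)

variable (d) in
/-- The morphisms from `V` to the summand `⊗^d` of `k^d`, as functionals on `V^{⊗ d}`. -/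
def multHom (V : DivPow k d) : Module.Dual k (⨂[k]^d V.carrier) →ₗ[k] (V ⟶ stdObj k d d) where
  toFun ξ := rankOne V (stdObj k d d) ξ (multVec k d)
  map_add' ξ ξ' := by
    rw [rankOne, rankOne, rankOne, ← map_add]
    congr 1
    refine LinearMap.ext fun x => ?_
    simp [add_smul]
  map_smul' r ξ := by
    rw [rankOne, rankOne, RingHom.id_apply, ← map_smul]
    congr 1
    refine LinearMap.ext fun x => ?_
    simp [smul_smul]

/-- `φ ⊗ ψ ↦ X (φ) x ⊗ Y (ψ) y` for functionals `φ` on `V^{⊗ d}` and `ψ` on `W^{⊗ d}`. -/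
def evalDual (X Y : RepGamma k d) {V W : DivPow k d} (x : X.obj.obj V) (y : Y.obj.obj W) :
    Module.Dual k (⨂[k]^d V.carrier) ⊗[k] Module.Dual k (⨂[k]^d W.carrier) →ₗ[k]
      X.obj.obj (stdObj k d d) ⊗[k] Y.obj.obj (stdObj k d d) :=
  TensorProduct.map ((actHom X V (stdObj k d d)).flip x ∘ₗ multHom d V)
    ((actHom Y W (stdObj k d d)).flip y ∘ₗ multHom d W)

lemma evalDual_tmul (X Y : RepGamma k d) {V W : DivPow k d} (x : X.obj.obj V) (y : Y.obj.obj W)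
    (φ : Module.Dual k (⨂[k]^d V.carrier)) (ψ : Module.Dual k (⨂[k]^d W.carrier)) :
    evalDual X Y x y (φ ⊗ₜ[k] ψ) =
      act X (multHom d V φ) x ⊗ₜ[k] act Y (multHom d W ψ) y := rfl

lemma act_multHom_comp (X : RepGamma k d) {V V' : DivPow k d} (f : V ⟶ V')
    (φ : Module.Dual k (⨂[k]^d V'.carrier)) (x : X.obj.obj V) :
    act X (multHom d V (φ ∘ₗ f.1)) x = act X (multHom d V' φ) (act X f x) := by
  rw [← act_comp]
  congr 2
  exact (comp_rankOne f φ _).symm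

/-- `shuffle` as a map to the tensor power of the object `V ⊗ W` of `Γ^d P_k`. -/
def objShuffle (V W : DivPow k d) :
    (⨂[k]^d V.carrier) ⊗[k] (⨂[k]^d W.carrier) →ₗ[k] (⨂[k]^d (V.tensorObj W).carrier) :=
  shuffle k d V.carrier W.carrier

/-- `unshuffle` as a map from the tensor power of the object `V ⊗ W` of `Γ^d P_k`. -/
def objUnshuffle (V W : DivPow k d) :
    (⨂[k]^d (V.tensorObj W).carrier) →ₗ[k] (⨂[k]^d V.carrier) ⊗[k] (⨂[k]^d W.carrier) :=
  unshuffle k d V.carrier W.carrier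

lemma objShuffle_comp_objUnshuffle (V W : DivPow k d) :
    objShuffle V W ∘ₗ objUnshuffle V W = LinearMap.id :=
  shuffle_unshuffle k d V.carrier W.carrier

lemma objUnshuffle_comp_objShuffle (V W : DivPow k d) :
    objUnshuffle V W ∘ₗ objShuffle V W = LinearMap.id :=
  unshuffle_shuffle k d V.carrier W.carrier

lemma coe_tensorHom {V V' W W' : DivPow k d} (f : V ⟶ V') (g : W ⟶ W') :
    (DivPow.tensorHom f g).1 =
      objShuffle V' W' ∘ₗ TensorProduct.map f.1 g.1 ∘ₗ objUnshuffle V W := rfl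

/-- The morphism `k^d ⊗ k^d ⟶ k^d` with values in the summand `⊗^d` that corresponds to the
coordinate of `(e_1 ⊗ e_1) ⊗ ⋯ ⊗ (e_d ⊗ e_d)`. -/
def multPair (k : Type u) [CommRing k] (d : ℕ) :
    (stdObj k d d).tensorObj (stdObj k d d) ⟶ stdObj k d d :=
  multHom d ((stdObj k d d).tensorObj (stdObj k d d))
    (TensorProduct.dualDistrib k _ _ (multCoord k d ⊗ₜ[k] multCoord k d) ∘ₗ
      objUnshuffle (stdObj k d d) (stdObj k d d))

lemma objUnshuffle_comp_tensorHom {V V' W W' : DivPow k d} (f : V ⟶ V') (g : W ⟶ W') :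
    objUnshuffle V' W' ∘ₗ (DivPow.tensorHom f g).1 =
      TensorProduct.map f.1 g.1 ∘ₗ objUnshuffle V W := by
  rw [coe_tensorHom, ← LinearMap.comp_assoc, objUnshuffle_comp_objShuffle, LinearMap.id_comp]

lemma dualDistrib_comp_map {A B A' B' : Type*} [AddCommGroup A] [Module k A] [AddCommGroup B]
    [Module k B] [AddCommGroup A'] [Module k A'] [AddCommGroup B'] [Module k B'] (f : A →ₗ[k] A')
    (g : B →ₗ[k] B') (z : Module.Dual k A' ⊗[k] Module.Dual k B') :
    TensorProduct.dualDistrib k A' B' z ∘ₗ TensorProduct.map f g =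
      TensorProduct.dualDistrib k A B (TensorProduct.map f.dualMap g.dualMap z) := by
  induction z with
  | zero => simp
  | add z z' hz hz' => rw [map_add, map_add, map_add, LinearMap.add_comp, hz, hz']
  | tmul φ ψ =>
    ext a b
    simp

/-- `x ⊗ y ↦ [m, x, y]`, with `m` the morphism `multPair`. -/
def tensorIncl (X Y : RepGamma k d) :
    X.obj.obj (stdObj k d d) ⊗[k] Y.obj.obj (stdObj k d d) →ₗ[k] TensorVal X Y (stdObj k d d) :=
  TensorProduct.lift (tensorMkHom X Y _ _ _ (multPair k d))

/-- The morphism `multPair` is universal: a decomposable functional on `V^{⊗ d} ⊗ W^{⊗ d}` is the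
pullback of the product of the two coordinates of `e_1 ⊗ ⋯ ⊗ e_d`. -/
lemma tensorHom_comp_multPair {V W : DivPow k d} (φ : Module.Dual k (⨂[k]^d V.carrier))
    (ψ : Module.Dual k (⨂[k]^d W.carrier)) :
    DivPow.tensorHom (multHom d V φ) (multHom d W ψ) ≫ multPair k d =
      multHom d (V.tensorObj W) (TensorProduct.dualDistrib k _ _ (φ ⊗ₜ[k] ψ) ∘ₗ
        objUnshuffle V W) := by
  refine (comp_rankOne _ _ _).trans ?_
  have h : TensorProduct.dualDistrib k _ _ (multCoord k d ⊗ₜ[k] multCoord k d) ∘ₗ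
      TensorProduct.map (multHom d V φ).1 (multHom d W ψ).1 =
      TensorProduct.dualDistrib k _ _ (φ ⊗ₜ[k] ψ) := by
    rw [dualDistrib_comp_map, TensorProduct.map_tmul]
    congr 2
    · exact multCoord_rankOne φ
    · exact multCoord_rankOne ψ
  rw [LinearMap.comp_assoc, objUnshuffle_comp_tensorHom, ← LinearMap.comp_assoc, h]
  rfl

/-- On a decomposable `z`, the coend relation moves the two functionals from `x` and `y` into the
morphism; linearity does the rest. -/
lemma tensorIncl_evalDual (X Y : RepGamma k d) {V W : DivPow k d} (x : X.obj.obj V)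
    (y : Y.obj.obj W)
    (z : Module.Dual k (⨂[k]^d V.carrier) ⊗[k] Module.Dual k (⨂[k]^d W.carrier)) :
    tensorIncl X Y (evalDual X Y x y z) = tensorMkHom X Y V W _
      (multHom d (V.tensorObj W) (TensorProduct.dualDistrib k _ _ z ∘ₗ
        objUnshuffle V W)) x y := by
  induction z with
  | zero => simp only [map_zero, LinearMap.zero_comp, LinearMap.zero_apply]
  | add z z' hz hz' =>
    rw [map_add, map_add, hz, hz', map_add, LinearMap.add_comp, map_add, map_add,
      LinearMap.add_apply, LinearMap.add_apply]
  | tmul φ ψ =>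
    rw [evalDual_tmul, tensorIncl, TensorProduct.lift.tmul, ← tensorMkHom_tensorHom,
      tensorHom_comp_multPair]

lemma tensorMap_tensorIncl {X Y Y' : RepGamma k d} (β : Y ⟶ Y')
    (z : X.obj.obj (stdObj k d d) ⊗[k] Y.obj.obj (stdObj k d d)) :
    tensorMap β (𝟙 (stdObj k d d)) (tensorIncl X Y z) =
      tensorIncl X Y' ((β.hom.app (stdObj k d d)).hom.lTensor _ z) := by
  induction z with
  | zero => simp
  | add z z' hz hz' => rw [map_add, map_add, hz, hz', map_add, map_add]
  | tmul x y => exact tensorMap_mk β (𝟙 _) _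

end TensorValue

/-! ### Factorization of the idempotent and vanishing of homology over a field -/

section Field

variable {k : Type u} [Field k] {d : ℕ}

/-- The tensor of functionals on `V^{⊗ d}` and `W^{⊗ d}` that describes the projection of
`h : V ⊗ W ⟶ k^d` to the summand `⊗^d` of `k^d`. -/
def dualOfHom (V W : DivPow k d) : (V.tensorObj W ⟶ stdObj k d d) →ₗ[k]
    Module.Dual k (⨂[k]^d V.carrier) ⊗[k] Module.Dual k (⨂[k]^d W.carrier) :=
  (TensorProduct.dualDistribEquiv k (⨂[k]^d V.carrier) (⨂[k]^d W.carrier)).symm.toLinearMap ∘ₗ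
    LinearMap.lcomp k k (objShuffle V W) ∘ₗ
    LinearMap.llcomp k _ _ _ (multCoord k d) ∘ₗ
    (gammaHom k d (V.tensorObj W).carrier (stdObj k d d).carrier).subtype

lemma dualDistrib_dualOfHom {V W : DivPow k d} (h : V.tensorObj W ⟶ stdObj k d d) :
    TensorProduct.dualDistrib k _ _ (dualOfHom V W h) =
      (multCoord k d ∘ₗ h.1) ∘ₗ objShuffle V W :=
  (TensorProduct.dualDistribEquiv k (⨂[k]^d V.carrier) (⨂[k]^d W.carrier)).apply_symm_apply _

lemma dualOfHom_eq_iff {V W : DivPow k d} (h : V.tensorObj W ⟶ stdObj k d d)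
    (z : Module.Dual k (⨂[k]^d V.carrier) ⊗[k] Module.Dual k (⨂[k]^d W.carrier)) :
    dualOfHom V W h = z ↔ (multCoord k d ∘ₗ h.1) ∘ₗ objShuffle V W =
      TensorProduct.dualDistrib k _ _ z := by
  rw [← dualDistrib_dualOfHom]
  exact (TensorProduct.dualDistribEquiv k (⨂[k]^d V.carrier)
    (⨂[k]^d W.carrier)).injective.eq_iff.symm

lemma dualOfHom_tensorHom {V V' W W' : DivPow k d} (f : V ⟶ V') (g : W ⟶ W')
    (h : V'.tensorObj W' ⟶ stdObj k d d) :
    dualOfHom V W (DivPow.tensorHom f g ≫ h) =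
      TensorProduct.map f.1.dualMap g.1.dualMap (dualOfHom V' W' h) := by
  rw [dualOfHom_eq_iff, ← dualDistrib_comp_map, dualDistrib_dualOfHom]
  rw [coe_comp, coe_tensorHom]
  simp only [LinearMap.comp_assoc, objUnshuffle_comp_objShuffle, LinearMap.comp_id]

lemma evalDual_dualMap (X Y : RepGamma k d) {V V' W W' : DivPow k d} (f : V ⟶ V') (g : W ⟶ W')
    (x : X.obj.obj V) (y : Y.obj.obj W)
    (z : Module.Dual k (⨂[k]^d V'.carrier) ⊗[k] Module.Dual k (⨂[k]^d W'.carrier)) :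
    evalDual X Y x y (TensorProduct.map f.1.dualMap g.1.dualMap z) =
      evalDual X Y (act X f x) (act Y g y) z := by
  induction z with
  | zero => simp
  | add z z' hz hz' => rw [map_add, map_add, hz, hz', map_add]
  | tmul φ ψ =>
    rw [TensorProduct.map_tmul, evalDual_tmul, evalDual_tmul, ← act_multHom_comp,
      ← act_multHom_comp]
    rfl

/-- The value on a generator of the map `tensorProj`. -/
def tensorProjGen (X Y : RepGamma k d) (t : Gen X Y (stdObj k d d)) :
    X.obj.obj (stdObj k d d) ⊗[k] Y.obj.obj (stdObj k d d) :=
  evalDual X Y t.x t.y (dualOfHom t.V t.W t.h)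

lemma evalDual_add_left (X Y : RepGamma k d) {V W : DivPow k d} (x x' : X.obj.obj V)
    (y : Y.obj.obj W) : evalDual X Y (x + x') y = evalDual X Y x y + evalDual X Y x' y := by
  rw [evalDual, map_add, LinearMap.add_comp, TensorProduct.map_add_left]
  rfl

lemma evalDual_add_right (X Y : RepGamma k d) {V W : DivPow k d} (x : X.obj.obj V)
    (y y' : Y.obj.obj W) : evalDual X Y x (y + y') = evalDual X Y x y + evalDual X Y x y' := by
  rw [evalDual, map_add, LinearMap.add_comp, TensorProduct.map_add_right]
  rfl

lemma evalDual_smul_left (X Y : RepGamma k d) {V W : DivPow k d} (r : k) (x : X.obj.obj V)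
    (y : Y.obj.obj W) : evalDual X Y (r • x) y = r • evalDual X Y x y := by
  rw [evalDual, map_smul, LinearMap.smul_comp, TensorProduct.map_smul_left]
  rfl

lemma evalDual_smul_right (X Y : RepGamma k d) {V W : DivPow k d} (r : k) (x : X.obj.obj V)
    (y : Y.obj.obj W) : evalDual X Y x (r • y) = r • evalDual X Y x y := by
  rw [evalDual, map_smul, LinearMap.smul_comp, TensorProduct.map_smul_right]
  rfl

/-- The coend relation holds because precomposing the morphism with `f ⊗ g` transposes the
functionals by `f` and `g`, which amounts to letting `f` and `g` act on `x` and `y`. -/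
lemma relators_le_ker_tensorProjGen (X Y : RepGamma k d) :
    relators X Y (stdObj k d d) ≤
      LinearMap.ker (Finsupp.linearCombination k (tensorProjGen X Y)) := by
  refine Submodule.span_le.2 fun r hr => ?_
  rw [SetLike.mem_coe, LinearMap.mem_ker]
  induction hr with
  | add_h V W h h' x y => simp [tensorProjGen]
  | add_x V W h x x' y => simp [tensorProjGen, evalDual_add_left]
  | add_y V W h x y y' => simp [tensorProjGen, evalDual_add_right]
  | smul_h V W r h x y => simp [tensorProjGen]
  | smul_x V W r h x y => simp [tensorProjGen, evalDual_smul_left]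
  | smul_y V W r h x y => simp [tensorProjGen, evalDual_smul_right]
  | nat f g h x y =>
    simp only [map_sub, Finsupp.linearCombination_single, one_smul, tensorProjGen,
      dualOfHom_tensorHom, evalDual_dualMap]
    exact sub_self _

/-- The projection of `(X ⊗ Y)(k^d)` to `X (k^d) ⊗ Y (k^d)`. -/
def tensorProj (X Y : RepGamma k d) : TensorVal X Y (stdObj k d d) →ₗ[k]
    X.obj.obj (stdObj k d d) ⊗[k] Y.obj.obj (stdObj k d d) :=
  (relators X Y (stdObj k d d)).liftQ _ (relators_le_ker_tensorProjGen X Y)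

lemma tensorProj_mk {X Y : RepGamma k d} (t : Gen X Y (stdObj k d d)) :
    tensorProj X Y (tensorMk t) = tensorProjGen X Y t := by
  refine (Submodule.liftQ_apply _ _ _).trans ?_
  rw [Finsupp.linearCombination_single, one_smul]

/-- Projecting extracts the functional of the morphism and including rebuilds a morphism from it;
the outcome is composition with the idempotent. -/
lemma tensorIncl_tensorProj {X Y : RepGamma k d} (z : TensorVal X Y (stdObj k d d)) :
    tensorIncl X Y (tensorProj X Y z) =
      act (internalTensor X Y) (weightIdem k d d fun _ => 1) z := by
  suffices h : tensorIncl X Y ∘ₗ tensorProj X Y =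
      tensorMap (𝟙 Y) (weightIdem k d d fun _ => 1) from
    congrArg (fun f : TensorVal X Y (stdObj k d d) →ₗ[k] TensorVal X Y (stdObj k d d) => f z) h
  apply tensorVal_ext
  intro t
  rw [LinearMap.comp_apply, tensorProj_mk, tensorProjGen, tensorIncl_evalDual,
    dualDistrib_dualOfHom, LinearMap.comp_assoc, objShuffle_comp_objUnshuffle, LinearMap.comp_id,
    tensorMap_mk]
  have h1 : multHom d (t.V.tensorObj t.W) (multCoord k d ∘ₗ t.h.1) =
      t.h ≫ weightIdem k d d (fun _ => 1) := (comp_weightIdem_one t.h).symm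
  rw [h1]
  rfl

lemma lTensor_tensorProj {X Y Y' : RepGamma k d} (β : Y ⟶ Y')
    (z : TensorVal X Y (stdObj k d d)) :
    (β.hom.app (stdObj k d d)).hom.lTensor _ (tensorProj X Y z) =
      tensorProj X Y' (tensorMap β (𝟙 (stdObj k d d)) z) := by
  suffices h : (β.hom.app (stdObj k d d)).hom.lTensor _ ∘ₗ tensorProj X Y =
      tensorProj X Y' ∘ₗ tensorMap β (𝟙 (stdObj k d d)) from
    congrArg (fun f : TensorVal X Y (stdObj k d d) →ₗ[k]
      X.obj.obj (stdObj k d d) ⊗[k] Y'.obj.obj (stdObj k d d) => f z) h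
  apply tensorVal_ext
  rintro ⟨V, W, h, x, y⟩
  rw [LinearMap.comp_apply, LinearMap.comp_apply, tensorProj_mk, tensorMap_mk, tensorProj_mk]
  change (β.hom.app (stdObj k d d)).hom.lTensor _ (evalDual X Y x y (dualOfHom V W h)) =
    evalDual X Y' x ((β.hom.app W).hom y) (dualOfHom V W h)
  induction dualOfHom V W h with
  | zero => simp
  | add z z' hz hz' => rw [map_add, map_add, hz, hz', map_add]
  | tmul φ ψ =>
    rw [evalDual_tmul, evalDual_tmul, LinearMap.lTensor_tmul, hom_act]

/-- By Yoneda an element of the middle term at `U` is a morphism from the representable functor of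
`U`, and that functor is projective. -/
lemma exists_of_exact {S : ShortComplex (RepGamma k d)} (hS : S.Exact) {U : DivPow k d}
    (x : S.X₂.obj.obj U) (hx : (S.g.hom.app U).hom x = 0) :
    ∃ w : S.X₁.obj.obj U, (S.f.hom.app U).hom w = x := by
  let V : PUnit.{u + 2} → DivPow k d := fun _ => U
  have h1 : sumReprDesc V S.X₂ (fun _ => x) ≫ S.g = 0 := by
    apply sumRepr_hom_ext
    intro i
    change (S.g.hom.app U).hom (((sumReprDesc V S.X₂ (fun _ => x)).hom.app U).hom
      (sumReprGen V i)) = 0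
    rw [show ((sumReprDesc V S.X₂ (fun _ => x)).hom.app U).hom (sumReprGen V i) = x from
      sumReprDesc_gen V S.X₂ (fun _ => x) i, hx]
  refine ⟨((hS.liftFromProjective _ h1).hom.app U).hom (sumReprGen V PUnit.unit), ?_⟩
  have h2 := congrArg (fun t : sumRepr V ⟶ S.X₂ => (t.hom.app U).hom (sumReprGen V PUnit.unit))
    (hS.liftFromProjective_comp _ h1)
  exact h2.trans (sumReprDesc_gen V S.X₂ (fun _ => x) PUnit.unit)

/-- The idempotent acts by zero on homology once it turns every cycle into a boundary. -/
lemma weightSpace_homology_eq_bot {S : ShortComplex (RepGamma k d)} {n : ℕ} {μ : Fin n → ℕ}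
    (h : ∀ z : S.X₂.obj.obj (stdObj k d n), (S.g.hom.app _).hom z = 0 →
      ∃ w : S.X₁.obj.obj (stdObj k d n), (S.f.hom.app _).hom w =
        act S.X₂ (weightIdem k d n μ) z) :
    weightSpace S.homology n μ = ⊥ := by
  rw [weightSpace_eq_bot_iff]
  ext1 y
  obtain ⟨z, rfl⟩ := surjective_of_epi S.homologyπ _ y
  have h1 : (S.g.hom.app _).hom ((S.iCycles.hom.app (stdObj k d n)).hom z) = 0 :=
    congrArg (fun t : S.cycles ⟶ S.X₃ => (t.hom.app (stdObj k d n)).hom z) S.iCycles_g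
  obtain ⟨w, hw⟩ := h _ h1
  have h2 : (S.toCycles.hom.app _).hom w = act S.cycles (weightIdem k d n μ) z := by
    apply injective_of_mono S.iCycles
    rw [hom_act, ← hw]
    exact congrArg (fun t : S.X₁ ⟶ S.X₂ => (t.hom.app (stdObj k d n)).hom w) S.toCycles_i
  rw [← hom_act, ← h2]
  exact congrArg (fun t : S.X₁ ⟶ S.homology => (t.hom.app (stdObj k d n)).hom w)
    S.toCycles_comp_homologyπ

/-- A cycle projects to a cycle of `X (k^d) ⊗ S (k^d)`, which is a boundary by flatness over a
field; including a preimage back exhibits the idempotent applied to the cycle as a boundary. -/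
lemma weightSpace_homology_internalTensor (X : RepGamma k d) {S : ShortComplex (RepGamma k d)}
    (hS : S.Exact) :
    weightSpace (S.map (internalTensorLeft X)).homology d (fun _ => 1) = ⊥ := by
  apply weightSpace_homology_eq_bot
  intro z hz
  have hex : Function.Exact (S.f.hom.app (stdObj k d d)).hom (S.g.hom.app (stdObj k d d)).hom := by
    intro x
    refine ⟨fun hx => exists_of_exact hS x hx, ?_⟩
    rintro ⟨w, rfl⟩
    exact congrArg (fun t : S.X₁ ⟶ S.X₃ => (t.hom.app (stdObj k d d)).hom w) S.zero
  have hex' := Module.Flat.lTensor_exact (X.obj.obj (stdObj k d d)) hex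
  have h1 : (S.g.hom.app (stdObj k d d)).hom.lTensor _ (tensorProj X S.X₂ z) = 0 :=
    (lTensor_tensorProj S.g z).trans ((congrArg (tensorProj X S.X₃) hz).trans (map_zero _))
  obtain ⟨w, hw⟩ := (hex' _).1 h1
  refine ⟨tensorIncl X S.X₁ w, ?_⟩
  refine (tensorMap_tensorIncl S.f w).trans ?_
  rw [hw]
  exact tensorIncl_tensorProj z

lemma weightSpace_homology_derivedInternalTensor [HasDerivedCategory.{w} (RepGamma k d)]
    (X Y : RepGamma k d) (i : ℤ) (hi : i ≠ 0) :
    weightSpace ((DerivedCategory.homologyFunctor (RepGamma k d) i).obj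
      (derivedInternalTensor X Y)) d (fun _ => 1) = ⊥ := by
  have h1 : (projectiveResolution Y).cochainComplex.ExactAt i := by
    have hq : QuasiIsoAt (projectiveResolution Y).π' i := inferInstance
    exact (quasiIsoAt_iff_exactAt' _ _
      (HomologicalComplex.exactAt_single_obj (ComplexShape.up ℤ) 0 Y i hi)).1 hq
  have h2 := weightSpace_homology_internalTensor X h1
  exact weightSpace_eq_bot_of_mono ((DerivedCategory.homologyFunctorFactors _ i).hom.app _) h2

end Field

end StrictPoly

end

theorem corollary3p4 {k : Type u} [Field k] {p : ℕ} [Fact p.Prime] [CharP k p] {d : ℕ}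
    [HasDerivedCategory.{w} (RepGamma k d)] (X Y : RepGamma k d) (i : ℤ) (hi : i ≠ 0) :
    Subsingleton (Sch ((DerivedCategory.homologyFunctor (RepGamma k d) i).obj
        (derivedInternalTensor X Y))) ∧
      (IsFinitelyGenerated X → IsFinitelyGenerated Y →
        ∀ L : RepGamma k d, IsCompositionFactor L
            ((DerivedCategory.homologyFunctor (RepGamma k d) i).obj (derivedInternalTensor X Y)) →
          ∀ lam : Fin d → ℕ, IsHighestWeight L lam → ¬ IsRestricted p lam) := by
  have h := weightSpace_homology_derivedInternalTensor X Y i hi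
  refine ⟨subsingleton_sch_of_weightSpace h, fun _ _ L hL lam hlam hp => ?_⟩
  obtain ⟨-, B, ι, π, hι, hπ⟩ := hL
  exact weightSpace_one_ne_bot_of_isRestricted hlam hp
    (weightSpace_eq_bot_of_epi π (weightSpace_eq_bot_of_mono ι h))
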